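/- Let $\mathcal A,\mathcal B$ be abelian categories, $\mathcal A$ with enough injectives, let $F:\mathcal A\to\mathcal B$ be an additive left exact functor, and let $\mathcal A'\subset\mathcal A$ and $\mathcal B'\subset\mathcal B$ be thick abelian subcategories, i.e. strictly full subcategories containing $0$ and closed under kernels, cokernels and extensions. Let $Q$ be a finite quiver (finitely many vertices and finitely many arrows) and let $\mathcal Q$ be the category it generates: its objects are the vertices and its morphisms are the paths. For an abelian category $\mathcal E$ let $\mathcal Q(\mathcal E)$ be the abelian category of functors $\mathcal Q\to\mathcal E$; for a thick abelian subcategory $\mathcal E'\subset\mathcal E$ let $\mathcal Q(\mathcal E')\subset\mathcal Q(\mathcal E)$ be the full subcategory of functors with values in $\mathcal E'$. For $*\in\{+,b\}$ let $D^*_{\mathcal E'}(\mathcal E)$ be the full subcategory of the derived category $D^*(\mathcal E)$ of complexes all of whose cohomology objects lie in $\mathcal E'$, where $D^b(\mathcal E)$ is regarded as a full subcategory of $D^+(\mathcal E)$. Let $F_{\mathcal Q}:\mathcal Q(\mathcal A)\to\mathcal Q(\mathcal B)$ be the functor $G\mapsto F\circ G$. Assume either that $Q$ has no oriented cycles (equivalently,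 that $\mathcal Q$ has only finitely many morphisms), or that $\mathcal A$ has countable products and $\mathcal B$ has countable coproducts, which are exact. Then $\mathcal Q(\mathcal A)$ has enough injectives, so that $F_{\mathcal Q}$ has a right derived functor $R(F_{\mathcal Q}):D^+(\mathcal Q(\mathcal A))\to D^+(\mathcal Q(\mathcal B))$, and the following hold. 1. If $RF:D^+(\mathcal A)\to D^+(\mathcal B)$ maps $D^+_{\mathcal A'}(\mathcal A)$ into $D^+_{\mathcal B'}(\mathcal B)$ and the restriction $RF:D^+_{\mathcal A'}(\mathcal A)\to D^+_{\mathcal B'}(\mathcal B)$ is an equivalence of categories, then $R(F_{\mathcal Q})$ maps $D^+_{\mathcal Q(\mathcal A')}(\mathcal Q(\mathcal A))$ into $D^+_{\mathcal Q(\mathcal B')}(\mathcal Q(\mathcal B))$ and the restriction $R(F_{\mathcal Q}):D^+_{\mathcal Q(\mathcal A')}(\mathcal Q(\mathcal A))\to D^+_{\mathcal Q(\mathcal B')}(\mathcal Q(\mathcal B))$ is an equivalence of categories. 2. If $RF$ maps $D^b_{\mathcal A'}(\mathcal A)$ into $D^b_{\mathcal B'}(\mathcal B)$ and the restriction $RF:D^b_{\mathcal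 A'}(\mathcal A)\to D^b_{\mathcal B'}(\mathcal B)$ is an equivalence of categories, then $R(F_{\mathcal Q})$ maps $D^b_{\mathcal Q(\mathcal A')}(\mathcal Q(\mathcal A))$ into $D^b_{\mathcal Q(\mathcal B')}(\mathcal Q(\mathcal B))$ and the restriction $R(F_{\mathcal Q}):D^b_{\mathcal Q(\mathcal A')}(\mathcal Q(\mathcal A))\to D^b_{\mathcal Q(\mathcal B')}(\mathcal Q(\mathcal B))$ is an equivalence of categories. -/

import Mathlib

open CategoryTheory Limits

/-- A thick abelian subcategory of an abelian category, as a property of objects: a (strictly) full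
subcategory which contains zero and is closed under kernels and cokernels (so that it is abelian
with exact inclusion) and under extensions. -/
structure IsThickAbelian {A : Type*} [Category* A] [Abelian A] (P : ObjectProperty A) : Prop where
  isClosedUnderIsomorphisms : P.IsClosedUnderIsomorphisms
  containsZero : P.ContainsZero
  isClosedUnderKernels : P.IsClosedUnderKernels
  isClosedUnderCokernels : P.IsClosedUnderCokernels
  isClosedUnderExtensions : P.IsClosedUnderExtensions

/-- The objects of `D⁺(A)` all of whose cohomology objects belong to `P`: these are the objects of
the full subcategory `D⁺_P(A)`. -/
def plusWithCohomologyIn {A : Type*} [Category* A] [Abelian A] [HasDerivedCategory A]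
    (P : ObjectProperty A) : ObjectProperty (DerivedCategory.Plus A) :=
  fun X => ∀ n : ℤ, P ((DerivedCategory.Plus.homologyFunctor A n).obj X)

/-- The objects of `D⁺(A)` which are cohomologically bounded and all of whose cohomology objects
belong to `P`: these are the objects of `D^b_P(A)`, as a full subcategory of `D⁺(A)`. -/
def boundedWithCohomologyIn {A : Type*} [Category* A] [Abelian A] [HasDerivedCategory A]
    (P : ObjectProperty A) : ObjectProperty (DerivedCategory.Plus A) :=
  fun X => DerivedCategory.TStructure.t.bounded (DerivedCategory.Plus.ι.obj X) ∧
    plusWithCohomologyIn P X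

/-- The functors `J ⥤ A` all of whose values belong to `P`: these are the objects of the full
subcategory of `J ⥤ A` consisting of the functors from `J` to the full subcategory `P`. -/
def functorsInto (J : Type*) [Category* J] {A : Type*} [Category* A] (P : ObjectProperty A) :
    ObjectProperty (J ⥤ A) :=
  fun G => ∀ j : J, P (G.obj j)

/-- The functor `R` sends objects of the full subcategory `P` to objects of the full subcategory
`P'`, and the functor between these full subcategories obtained by restriction of `R` is an
equivalence of categories. -/
def RestrictsToEquivalence {C D : Type*} [Category* C] [Category* D] (R : C ⥤ D)
    (P : ObjectProperty C) (P' : ObjectProperty D) : Prop :=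
  ∃ h : ∀ X : C, P X → P' (R.obj X),
    (P'.lift (P.ι ⋙ R) (fun X => h X.obj X.property)).IsEquivalence

/-- The functor `F_J : (J ⥤ A) ⥤ (J ⥤ B)`, `G ↦ G ⋙ F`, induced by a functor `F : A ⥤ B`. -/
abbrev functorOnDiagrams (J : Type*) [Category* J] {A B : Type*} [Category* A] [Category* B]
    (F : A ⥤ B) : (J ⥤ A) ⥤ (J ⥤ B) :=
  (Functor.whiskeringRight J A B).obj F

/-!
Representations of the quiver `Q` in an abelian category `E` are functors `Paths V ⥤ E`. The
category of representations has dimension one relative to `E`, and this is seen in two ways.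

On the side of `B`, the evaluation at a vertex has an exact left adjoint (induction), as the
coproducts indexed by paths are exact, and every complex of representations `W` has the standard
resolution `0 ⟶ ⨁ₐ Ind_{t(a)} W_{s(a)} ⟶ ⨁ᵢ Indᵢ Wᵢ ⟶ W ⟶ 0` (`stdShortComplex`), where `a` runs
over the arrows and `i` over the vertices. Mapping its triangle to `Z` gives the following: a family
of morphisms `Wᵢ ⟶ Zᵢ` in `D(B)` which commutes with the arrows comes from a morphism `W ⟶ Z`
(`exists_evQ_eq`), and the morphisms `W ⟶ Y⟦1⟧` which vanish at all vertices are the families of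
morphisms `W_{s(a)} ⟶ Y_{t(a)}` indexed by the arrows, modulo commutators of families `Wᵢ ⟶ Yᵢ`.

On the side of `A`, there need not be exact coproducts, but the analogous statements hold for
complexes of injective representations up to homotopy: as the extensions of `G` by an injective
representation `H` split, every family of morphisms `G_{s(a)} ⟶ H_{t(a)}` is the family of
commutators of some `Gᵢ ⟶ Hᵢ` (`exists_commutator_of_injective`). Injective representations exist
because coinduction from a vertex, given by products indexed by paths, preserves injectives; for the
same reason, their values are injective.

The right derived functor of `F` restricts to an equivalence if and only if `F` induces bijections
from homotopy classes to morphisms in `D(B)` on suitable bounded below complexes of injective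
objects (`DerivedFullyFaithful`), and hits all the required objects
(`restrictsToEquivalence_rightDerivedFunctorPlus_iff`). The first condition passes to
representations by comparing both descriptions of morphisms, which are matched by computing the
connecting morphism of the standard resolution on cocycles
(`DerivedFullyFaithful.functorOnDiagrams`). For the second one, an object of `D⁺` of representations
in `B` is lifted at each vertex; its arrows are lifted to morphisms of complexes, and since the path
category is free, this is a representation in complexes; an injective resolution of it has the
required image (`exists_injectiveModel_diagram`). The conditions on cohomology are only used
through their invariance under shifts and the fact that they can be tested at the vertices, so that
the bounded below and the bounded cases are treated together
(`restrictsToEquivalence_functorOnDiagrams`).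
-/

-- several lemmas do not need all the instances of their section
set_option linter.unusedSectionVars false

/-! ### Extensions of representations of a quiver -/

section Representations

variable {V : Type*} [Quiver V] {A : Type*} [Category* A] [Abelian A]

/-- The source of an arrow of a quiver, as an object of the category of paths. -/
abbrev Quiver.Total.src (a : Quiver.Total V) : Paths V := a.left

/-- The target of an arrow of a quiver, as an object of the category of paths. -/
abbrev Quiver.Total.tgt (a : Quiver.Total V) : Paths V := a.right

/-- An arrow of a quiver, as a morphism of the category of paths. -/
def Quiver.Total.arrow (a : Quiver.Total V) : a.src ⟶ a.tgt := a.hom.toPath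

/-- The extension of a representation `G` by a representation `H` of a quiver which is given by an
arbitrary family of morphisms `h a : G a.src ⟶ H a.tgt` indexed by the arrows: its value at a
vertex `i` is `H i ⊞ G i`, and `h` is the off-diagonal entry of the action of the arrows. -/
noncomputable def quiverExtension (G H : Paths V ⥤ A)
    (h : ∀ a : Quiver.Total V, G.obj a.src ⟶ H.obj a.tgt) : Paths V ⥤ A :=
  Paths.lift
    { obj := fun i => H.obj i ⊞ G.obj i
      map := fun {s t} b =>
        let a : Quiver.Total V := ⟨s, t, b⟩
        (biprod.desc (H.map a.arrow ≫ biprod.inl) (h a ≫ biprod.inl + G.map a.arrow ≫ biprod.inr) :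
          H.obj a.src ⊞ G.obj a.src ⟶ H.obj a.tgt ⊞ G.obj a.tgt) }

lemma quiverExtension_map (G H : Paths V ⥤ A)
    (h : ∀ a : Quiver.Total V, G.obj a.src ⟶ H.obj a.tgt) (a : Quiver.Total V) :
    (quiverExtension G H h).map a.arrow =
      biprod.desc (H.map a.arrow ≫ biprod.inl)
        (h a ≫ biprod.inl + G.map a.arrow ≫ biprod.inr) :=
  Paths.lift_toPath _ _

/-- Over the path category of a quiver, `Ext¹(G, H)` is the cokernel of the map which sends a family
`k i : G i ⟶ H i` to the family of its commutators with the arrows. Hence any family indexed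
by the arrows is a family of commutators when `H` is injective. -/
lemma exists_commutator_of_injective (G H : Paths V ⥤ A) [Injective H]
    (h : ∀ a : Quiver.Total V, G.obj a.src ⟶ H.obj a.tgt) :
    ∃ k : ∀ i : Paths V, G.obj i ⟶ H.obj i, ∀ a : Quiver.Total V,
      h a = k a.src ≫ H.map a.arrow - G.map a.arrow ≫ k a.tgt := by
  let l : ∀ i : Paths V, H.obj i ⟶ (quiverExtension G H h).obj i :=
    fun i => (biprod.inl : H.obj i ⟶ H.obj i ⊞ G.obj i)
  let l' : ∀ i : Paths V, G.obj i ⟶ (quiverExtension G H h).obj i :=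
    fun i => (biprod.inr : G.obj i ⟶ H.obj i ⊞ G.obj i)
  have hl : ∀ a : Quiver.Total V,
      l a.src ≫ (quiverExtension G H h).map a.arrow = H.map a.arrow ≫ l a.tgt := fun a => by
    rw [quiverExtension_map]; exact biprod.inl_desc _ _
  have hl' : ∀ a : Quiver.Total V, l' a.src ≫ (quiverExtension G H h).map a.arrow =
      h a ≫ l a.tgt + G.map a.arrow ≫ l' a.tgt := fun a => by
    rw [quiverExtension_map]; exact biprod.inr_desc _ _
  let j : H ⟶ quiverExtension G H h := Paths.liftNatTrans l (fun {s t} b => (hl ⟨s, t, b⟩).symm)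
  have : ∀ i, Mono (j.app i) := fun i =>
    inferInstanceAs (Mono (biprod.inl : H.obj i ⟶ H.obj i ⊞ G.obj i))
  have : Mono j := NatTrans.mono_of_mono_app j
  let r : quiverExtension G H h ⟶ H := Injective.factorThru (𝟙 H) j
  have hr : j ≫ r = 𝟙 H := Injective.comp_factorThru _ _
  have hr' : ∀ i, l i ≫ r.app i = 𝟙 _ := NatTrans.congr_app hr
  refine ⟨fun i => l' i ≫ r.app i, fun a => ?_⟩
  have h1 := l' a.src ≫= r.naturality a.arrow
  rw [← Category.assoc, hl', Preadditive.add_comp, Category.assoc, hr', Category.comp_id,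
    ← Category.assoc (l' a.src)] at h1
  rw [← h1, Category.assoc, add_sub_cancel_right]

end Representations

/-! ### Injective functors -/

section Injectives

variable {J : Type*} [Category* J] [Finite J] {A : Type*} [Category* A] [Abelian A]
  [∀ i j : J, HasProductsOfShape (i ⟶ j) A] [EnoughInjectives A]

/-- Every functor `J ⥤ A` embeds into a finite product of the functors coinduced by injective
objects of `A`; this functor is injective, and so are its values. -/
lemma exists_mono_to_injective_functor (G : J ⥤ A) :
    ∃ (I : J ⥤ A) (f : G ⟶ I), Mono f ∧ Injective I ∧ ∀ j, Injective (I.obj j) := by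
  let R : J → (J ⥤ A) := fun i => (evaluationRightAdjoint A i).obj (Injective.under (G.obj i))
  have hR : ∀ i, Injective (R i) := fun i =>
    Injective.injective_of_adjoint (evaluationAdjunctionLeft A i) _
  let f : ∀ i, G ⟶ R i := fun i => ((evaluationAdjunctionLeft A i).homEquiv _ _) (Injective.ι _)
  have hf : ∀ i, Mono ((f i).app i) := fun i => by
    have h : (f i).app i ≫ Pi.π (fun _ : i ⟶ i => Injective.under (G.obj i)) (𝟙 i) =
        Injective.ι (G.obj i) := by
      simp only [f, evaluationAdjunctionLeft, Adjunction.mkOfHomEquiv_homEquiv, Equiv.coe_fn_mk]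
      exact (Pi.lift_π (fun g : i ⟶ i => G.map g ≫ Injective.ι (G.obj i)) (𝟙 i)).trans (by simp)
    have : Mono ((f i).app i ≫ Pi.π (fun _ : i ⟶ i => Injective.under (G.obj i)) (𝟙 i)) := by
      rw [h]; infer_instance
    exact mono_of_mono _ (Pi.π (fun _ : i ⟶ i => Injective.under (G.obj i)) (𝟙 i))
  refine ⟨∏ᶜ R, Pi.lift f, ?_, inferInstance, fun j => ?_⟩
  · have : ∀ j, Mono ((Pi.lift f).app j) := fun j => by
      have h : (Pi.lift f).app j ≫ (Pi.π R j).app j = (f j).app j := by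
        rw [← NatTrans.comp_app, Pi.lift_π]
      have : Mono ((Pi.lift f).app j ≫ (Pi.π R j).app j) := by rw [h]; exact hf j
      exact mono_of_mono _ ((Pi.π R j).app j)
    exact NatTrans.mono_of_mono_app _
  · have : ∀ i, Injective ((R i).obj j) := fun i =>
      inferInstanceAs (Injective (∏ᶜ fun _ : j ⟶ i => Injective.under (G.obj i)))
    exact Injective.of_iso (PreservesProduct.iso ((evaluation J A).obj j) R).symm
      (inferInstanceAs (Injective (∏ᶜ fun i => (R i).obj j)))

variable (J A) in
lemma enoughInjectives_functor : EnoughInjectives (J ⥤ A) where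
  presentation G := by
    obtain ⟨I, f, hf, hI, -⟩ := exists_mono_to_injective_functor G
    exact ⟨⟨I, hI, f, hf⟩⟩

/-- An injective functor is a retract of a product of coinduced functors, hence its values are
injective. -/
lemma injective_obj_of_injective (I : J ⥤ A) [Injective I] (j : J) : Injective (I.obj j) := by
  obtain ⟨K, f, hf, -, hK⟩ := exists_mono_to_injective_functor I
  let r : K ⟶ I := Injective.factorThru (𝟙 I) f
  have hr : f ≫ r = 𝟙 I := Injective.comp_factorThru _ _
  have := hK j
  exact Retract.injective (X := I.obj j) (Y := K.obj j) ⟨f.app j, r.app j, NatTrans.congr_app hr j⟩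

end Injectives

/-! ### Finiteness of path categories -/

section Paths

variable {V : Type*} [Quiver V]

/-- A finite quiver without oriented cycles has finitely many paths. -/
lemma finite_path_of_no_cycle [Finite V] [∀ i j : V, Finite (i ⟶ j)]
    (hV : ∀ (i : V) (p : Quiver.Path i i), p = Quiver.Path.nil) (i j : V) :
    Finite (Quiver.Path i j) := by
  -- the vertices are ordered by the existence of a path of positive length
  let r : V → V → Prop := fun s t => ∃ (u : V) (_ : Quiver.Path s u), Nonempty (u ⟶ t)
  have : IsTrans V r := ⟨fun s t u ⟨x, p, ⟨a⟩⟩ ⟨y, q, ⟨b⟩⟩ => ⟨y, (p.cons a).comp q, ⟨b⟩⟩⟩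
  have : Std.Irrefl r := ⟨fun s ⟨u, p, ⟨a⟩⟩ => by
    have := hV s (p.cons a)
    cases this⟩
  have wf : WellFounded r := Finite.wellFounded_of_trans_of_irrefl r
  induction j using wf.induction with
  | _ j ih =>
    have : ∀ x : (Σ k : V, k ⟶ j), Finite (Quiver.Path i x.1) := fun x =>
      ih x.1 ⟨x.1, Quiver.Path.nil, ⟨x.2⟩⟩
    have : Finite (Σ x : (Σ k : V, k ⟶ j), Quiver.Path i x.1) := inferInstance
    refine Finite.of_surjective (α := PLift (i = j) ⊕ (Σ x : (Σ k : V, k ⟶ j), Quiver.Path i x.1))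
      (fun x => match x with
        | Sum.inl h => h.down ▸ Quiver.Path.nil
        | Sum.inr y => y.2.cons y.1.2) ?_
    intro p
    cases p with
    | nil => exact ⟨Sum.inl ⟨rfl⟩, rfl⟩
    | cons q a => exact ⟨Sum.inr ⟨⟨_, a⟩, q⟩, rfl⟩

lemma countable_path [Countable V] [∀ i j : V, Countable (i ⟶ j)] (i j : V) :
    Countable (Quiver.Path i j) := by
  have key : ∀ (n : ℕ) (j : V), Countable {p : Quiver.Path i j // p.length = n} := by
    intro n
    induction n with
    | zero =>
      intro j
      have : Subsingleton {p : Quiver.Path i j // p.length = 0} := by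
        refine ⟨fun ⟨p, hp⟩ ⟨q, hq⟩ => ?_⟩
        cases p with
        | nil => cases q with
          | nil => rfl
          | cons _ _ => simp at hq
        | cons _ _ => simp at hp
      infer_instance
    | succ n ih =>
      intro j
      refine Function.Surjective.countable
        (f := fun x : (Σ x : (Σ k : V, k ⟶ j), {p : Quiver.Path i x.1 // p.length = n}) =>
          (⟨x.2.1.cons x.1.2, by simp [x.2.2]⟩ : {p : Quiver.Path i j // p.length = n + 1})) ?_
      rintro ⟨p, hp⟩
      cases p with
      | nil => simp at hp
      | cons q a => exact ⟨⟨⟨_, a⟩, q, by simpa using hp⟩, rfl⟩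
  refine Function.Surjective.countable
    (f := fun x : (Σ n : ℕ, {p : Quiver.Path i j // p.length = n}) => x.2.1)
    fun p => ⟨⟨_, p, rfl⟩, rfl⟩

end Paths

/-! ### Evaluation of complexes of functors -/

section Evaluation

open CochainComplex.HomComplex

variable {J : Type*} [Category* J] {E : Type*} [Category* E] [Preadditive E]

/-- The evaluation at `i : J` of complexes of functors `J ⥤ E`. -/
abbrev evC (i : J) : CochainComplex (J ⥤ E) ℤ ⥤ CochainComplex E ℤ :=
  ((evaluation J E).obj i).mapHomologicalComplex (.up ℤ)

/-- The action of a morphism of `J` on the values of a complex of functors `J ⥤ E`. -/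
def evCMap (X : CochainComplex (J ⥤ E) ℤ) {i j : J} (a : i ⟶ j) :
    (evC i).obj X ⟶ (evC j).obj X where
  f n := (X.X n).map a
  comm' _ _ _ := (X.d _ _).naturality a

lemma evCMap_f (X : CochainComplex (J ⥤ E) ℤ) {i j : J} (a : i ⟶ j) (n : ℤ) :
    (evCMap X a).f n = (X.X n).map a := rfl

lemma evC_map_evCMap {X Y : CochainComplex (J ⥤ E) ℤ} (f : X ⟶ Y) {i j : J} (a : i ⟶ j) :
    (evC i).map f ≫ evCMap Y a = evCMap X a ≫ (evC j).map f := by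
  ext n
  exact ((f.f n).naturality a).symm

/-- The complex of functors `J ⥤ E` given by a functor from `J` to complexes in `E`. -/
def complexOfFunctor (G : J ⥤ CochainComplex E ℤ) : CochainComplex (J ⥤ E) ℤ where
  X n := G ⋙ HomologicalComplex.eval E (.up ℤ) n
  d n m := { app := fun i => (G.obj i).d n m
             naturality := fun _ _ a => (G.map a).comm n m }
  d_comp_d' n m p _ _ := by
    ext i
    exact (G.obj i).d_comp_d n m p
  shape n m h := by
    ext i
    exact (G.obj i).shape n m h

/-- The values of the complex of functors given by a functor to complexes. -/
def evCObjComplexOfFunctor (G : J ⥤ CochainComplex E ℤ) (i : J) :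
    (evC i).obj (complexOfFunctor G) ≅ G.obj i :=
  HomologicalComplex.Hom.isoOfComponents (fun _ => Iso.refl _)
    (fun _ _ _ => (Category.id_comp _).trans (Category.comp_id _).symm)

lemma evCMap_complexOfFunctor (G : J ⥤ CochainComplex E ℤ) {i j : J} (a : i ⟶ j) :
    evCMap (complexOfFunctor G) a ≫ (evCObjComplexOfFunctor G j).hom =
      (evCObjComplexOfFunctor G i).hom ≫ G.map a := by
  ext n
  exact (Category.comp_id _).trans (Category.id_comp _).symm

/-- The evaluation at `i : J` of a cochain between complexes of functors. -/
abbrev evCochain {X Y : CochainComplex (J ⥤ E) ℤ} {n : ℤ} (i : J) (z : Cochain X Y n) :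
    Cochain ((evC i).obj X) ((evC i).obj Y) n :=
  z.map ((evaluation J E).obj i)

lemma δ_evCochain {X Y : CochainComplex (J ⥤ E) ℤ} {n m : ℤ} (i : J) (z : Cochain X Y n) :
    δ n m (evCochain i z) = evCochain i (δ n m z) :=
  δ_map _ _ _ _

lemma evCochain_ofHom {X Y : CochainComplex (J ⥤ E) ℤ} (i : J) (f : X ⟶ Y) :
    evCochain i (Cochain.ofHom f) = Cochain.ofHom ((evC i).map f) :=
  Cochain.map_ofHom _ _ _ _

lemma cochain_ext_of_evCochain {X Y : CochainComplex (J ⥤ E) ℤ} {n : ℤ} {z z' : Cochain X Y n}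
    (h : ∀ i, evCochain i z = evCochain i z') : z = z' := by
  ext p q hpq i
  exact Cochain.congr_v (h i) p q hpq

end Evaluation

/-! ### Commutators with the arrows -/

section Commutators

open CochainComplex.HomComplex

variable {V : Type*} [Quiver V] {E : Type*} [Category* E] [Preadditive E]
  {X Y : CochainComplex (Paths V ⥤ E) ℤ}

/-- The failure of a family of cochains, indexed by the vertices of a quiver, to commute with the
action of an arrow. -/
noncomputable def arrowCommutator {n : ℤ}
    (k : ∀ i : Paths V, Cochain ((evC i).obj X) ((evC i).obj Y) n)
    (a : Quiver.Total V) : Cochain ((evC a.src).obj X) ((evC a.tgt).obj Y) n :=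
  (k a.src).comp (Cochain.ofHom (evCMap Y a.arrow)) (add_zero n) -
    (Cochain.ofHom (evCMap X a.arrow)).comp (k a.tgt) (zero_add n)

lemma arrowCommutator_sub {n : ℤ} (k k' : ∀ i : Paths V, Cochain ((evC i).obj X) ((evC i).obj Y) n)
    (a : Quiver.Total V) :
    arrowCommutator (fun i => k i - k' i) a = arrowCommutator k a - arrowCommutator k' a := by
  simp only [arrowCommutator, Cochain.sub_comp, Cochain.comp_sub]
  abel

lemma δ_arrowCommutator {n m : ℤ} (k : ∀ i : Paths V, Cochain ((evC i).obj X) ((evC i).obj Y) n)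
    (a : Quiver.Total V) :
    δ n m (arrowCommutator k a) = arrowCommutator (fun i => δ n m (k i)) a := by
  simp [arrowCommutator]

lemma arrowCommutator_ofHom (f : ∀ i : Paths V, (evC i).obj X ⟶ (evC i).obj Y)
    (a : Quiver.Total V) :
    arrowCommutator (fun i => Cochain.ofHom (f i)) a =
      Cochain.ofHom (f a.src ≫ evCMap Y a.arrow - evCMap X a.arrow ≫ f a.tgt) := by
  simp [arrowCommutator]

lemma arrowCommutator_evCochain {n : ℤ} (z : Cochain X Y n) (a : Quiver.Total V) :
    arrowCommutator (fun i => evCochain i z) a = 0 := by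
  ext p q hpq
  simp only [arrowCommutator, Cochain.sub_v, Cochain.comp_zero_cochain_v, Cochain.ofHom_v, evCMap_f,
    Cochain.zero_cochain_comp_v, Cochain.zero_v, sub_eq_zero]
  exact ((z.v p q hpq).naturality a.arrow).symm

/-- A family of cochains which commutes with the arrows is natural, as the path category is free. -/
lemma exists_cochain_of_commutator_eq_zero {n : ℤ}
    (k : ∀ i : Paths V, Cochain ((evC i).obj X) ((evC i).obj Y) n)
    (hk : ∀ a, arrowCommutator k a = 0) : ∃ z : Cochain X Y n, ∀ i, evCochain i z = k i := by
  refine ⟨Cochain.mk (fun p q hpq => Paths.liftNatTrans (fun i => (k i).v p q hpq)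
    (fun {s t} b => ?_)), fun i => ?_⟩
  · have := Cochain.congr_v (hk ⟨s, t, b⟩) p q hpq
    simp only [arrowCommutator, Cochain.sub_v, Cochain.comp_zero_cochain_v, Cochain.ofHom_v,
      evCMap_f, Cochain.zero_cochain_comp_v, Cochain.zero_v, sub_eq_zero] at this
    exact this.symm
  · ext p q hpq
    rfl

end Commutators

section Injective

open CochainComplex.HomComplex

variable {V : Type*} [Quiver V] {E : Type*} [Category* E] [Abelian E]
  {X Y : CochainComplex (Paths V ⥤ E) ℤ}

/-- The commutator condition of `exists_commutator_of_injective`, degree by degree. -/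
lemma exists_commutator_eq {n : ℤ} [∀ n, Injective (Y.X n)]
    (h : ∀ a : Quiver.Total V, Cochain ((evC a.src).obj X) ((evC a.tgt).obj Y) n) :
    ∃ k : ∀ i : Paths V, Cochain ((evC i).obj X) ((evC i).obj Y) n,
      ∀ a, arrowCommutator k a = h a := by
  choose k hk using fun (p q : ℤ) (hpq : p + n = q) =>
    exists_commutator_of_injective (X.X p) (Y.X q) (fun a => (h a).v p q hpq)
  refine ⟨fun i => Cochain.mk (fun p q hpq => k p q hpq i), fun a => ?_⟩
  ext p q hpq
  rw [hk p q hpq a]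
  simp only [arrowCommutator, Cochain.sub_v, Cochain.comp_zero_cochain_v, Cochain.ofHom_v, evCMap_f,
    Cochain.zero_cochain_comp_v]
  rfl

/-- A family of morphisms of complexes which commute with the arrows up to homotopy is homotopic
to a family which commutes strictly. -/
lemma exists_hom_of_homotopy_commutative [∀ n, Injective (Y.X n)]
    (f : ∀ i : Paths V, (evC i).obj X ⟶ (evC i).obj Y)
    (hf : ∀ a : Quiver.Total V,
      Nonempty (Homotopy (f a.src ≫ evCMap Y a.arrow) (evCMap X a.arrow ≫ f a.tgt))) :
    ∃ g : X ⟶ Y, ∀ i, Nonempty (Homotopy ((evC i).map g) (f i)) := by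
  obtain ⟨k, hk⟩ := exists_commutator_eq (X := X) (Y := Y)
    (fun a => Cochain.ofHomotopy (hf a).some)
  obtain ⟨z, hz⟩ := exists_cochain_of_commutator_eq_zero (X := X) (Y := Y)
    (fun i => Cochain.ofHom (f i) - δ (-1) 0 (k i)) (fun a => by
      rw [arrowCommutator_sub, arrowCommutator_ofHom, ← δ_arrowCommutator, hk,
        δ_ofHomotopy, Cochain.ofHom_sub, sub_self])
  have hz0 : δ 0 1 z = 0 := cochain_ext_of_evCochain (fun i => by
    rw [← δ_evCochain, hz]
    simp [δ_δ])
  refine ⟨Cocycle.homOf (Cocycle.mk z 1 (zero_add 1) hz0), fun i =>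
    ⟨(Cochain.equivHomotopy _ _).symm ⟨-k i, ?_⟩⟩⟩
  have : Cochain.ofHom ((evC i).map (Cocycle.homOf (Cocycle.mk z 1 (zero_add 1) hz0))) =
      evCochain i z := by
    rw [← evCochain_ofHom]
    simp
  rw [this, hz, δ_neg]
  abel

/-- Every family of morphisms of complexes indexed by the arrows is a family of commutators of
cochains of degree `0`, the differentials of which form a cocycle of degree `1`. -/
lemma exists_cocycle_of_arrows [∀ n, Injective (Y.X n)]
    (h : ∀ a : Quiver.Total V, (evC a.src).obj X ⟶ (evC a.tgt).obj Y) :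
    ∃ (k : ∀ i : Paths V, Cochain ((evC i).obj X) ((evC i).obj Y) 0) (z : Cocycle X Y 1),
      (∀ a, arrowCommutator k a = Cochain.ofHom (h a)) ∧
        ∀ i, evCochain i z.1 = δ 0 1 (k i) := by
  obtain ⟨k, hk⟩ := exists_commutator_eq (X := X) (Y := Y) (fun a => Cochain.ofHom (h a))
  obtain ⟨z, hz⟩ := exists_cochain_of_commutator_eq_zero (X := X) (Y := Y)
    (fun i => δ 0 1 (k i)) (fun a => by rw [← δ_arrowCommutator, hk, δ_ofHom])
  refine ⟨k, Cocycle.mk z 2 (by lia) (cochain_ext_of_evCochain (fun i => ?_)), hk, hz⟩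
  rw [← δ_evCochain, hz]
  simp [δ_δ]

/-- A cocycle of degree `1` which is a coboundary at each vertex comes from a family of morphisms
indexed by the arrows; this is the converse of `exists_cocycle_of_arrows`. -/
lemma exists_arrows_of_cocycle (z : Cocycle X Y 1)
    (k : ∀ i : Paths V, Cochain ((evC i).obj X) ((evC i).obj Y) 0)
    (hk : ∀ i, evCochain i z.1 = δ 0 1 (k i)) :
    ∃ h : ∀ a : Quiver.Total V, (evC a.src).obj X ⟶ (evC a.tgt).obj Y,
      ∀ a, arrowCommutator k a = Cochain.ofHom (h a) := by
  refine ⟨fun a => Cocycle.homOf (Cocycle.mk (arrowCommutator k a) 1 (zero_add 1) ?_), fun a => ?_⟩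
  · rw [δ_arrowCommutator]
    simp only [← hk]
    exact arrowCommutator_evCochain _ a
  · simp

/-- The cocycle attached to a family of morphisms indexed by the arrows is a coboundary when this
family consists of the commutators, up to homotopy, of morphisms of complexes. -/
lemma exists_cobounding_of_arrows [∀ n, Injective (Y.X n)] (z : Cocycle X Y 1)
    (k : ∀ i : Paths V, Cochain ((evC i).obj X) ((evC i).obj Y) 0)
    (hk : ∀ i, evCochain i z.1 = δ 0 1 (k i))
    (h : ∀ a : Quiver.Total V, (evC a.src).obj X ⟶ (evC a.tgt).obj Y)
    (hh : ∀ a, arrowCommutator k a = Cochain.ofHom (h a))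
    (l : ∀ i : Paths V, (evC i).obj X ⟶ (evC i).obj Y)
    (hl : ∀ a : Quiver.Total V, Nonempty (Homotopy (h a)
      (l a.src ≫ evCMap Y a.arrow - evCMap X a.arrow ≫ l a.tgt))) :
    ∃ y : Cochain X Y 0, δ 0 1 y = z.1 := by
  obtain ⟨m, hm⟩ := exists_commutator_eq (X := X) (Y := Y)
    (fun a => Cochain.ofHomotopy (hl a).some)
  obtain ⟨y, hy⟩ := exists_cochain_of_commutator_eq_zero (X := X) (Y := Y)
    (fun i => (k i - Cochain.ofHom (l i)) - δ (-1) 0 (m i)) (fun a => by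
      rw [arrowCommutator_sub, arrowCommutator_sub, hh, arrowCommutator_ofHom, ← δ_arrowCommutator,
        hm, δ_ofHomotopy, sub_self])
  refine ⟨y, cochain_ext_of_evCochain (fun i => ?_)⟩
  rw [← δ_evCochain, hy, hk]
  simp [δ_δ]

end Injective

/-! ### Induced and free complexes of functors -/

section AdjunctionOnComplexes

variable {C D : Type*} [Category* C] [Category* D] [Preadditive C] [Preadditive D]
  {F : C ⥤ D} {G : D ⥤ C} [F.Additive] [G.Additive]

/-- The adjunction between categories of complexes induced by an adjunction between additive
functors. -/
def adjunctionOnComplexes (adj : F ⊣ G) {ι : Type*} (c : ComplexShape ι) :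
    F.mapHomologicalComplex c ⊣ G.mapHomologicalComplex c :=
  Adjunction.mkOfUnitCounit
    { unit :=
        { app := fun X =>
            { f := fun n => adj.unit.app (X.X n)
              comm' := fun _ _ _ => (adj.unit.naturality _).symm }
          naturality := fun X Y f => by
            ext n
            exact adj.unit.naturality (f.f n) }
      counit :=
        { app := fun X =>
            { f := fun n => adj.counit.app (X.X n)
              comm' := fun _ _ _ => (adj.counit.naturality _).symm }
          naturality := fun X Y f => by
            ext n
            exact adj.counit.naturality (f.f n) }
      left_triangle := by
        ext X n
        simp
        exact adj.left_triangle_components _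
      right_triangle := by
        ext X n
        simp
        exact adj.right_triangle_components _ }

end AdjunctionOnComplexes

section Induction

variable {J : Type*} [Category* J] {E : Type*} [Category* E] [Abelian E]
  [∀ i j : J, HasCoproductsOfShape (i ⟶ j) E]

instance evaluationLeftAdjoint_additive (i : J) : (evaluationLeftAdjoint E i).Additive :=
  (evaluationAdjunctionRight E i).left_adjoint_additive

instance evaluationLeftAdjoint_preservesFiniteColimits (i : J) :
    PreservesFiniteColimits (evaluationLeftAdjoint E i) :=
  have := (evaluationAdjunctionRight E i).leftAdjoint_preservesColimits
  inferInstance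

/-- The values of `evaluationLeftAdjoint E i` are given by coproducts of constant families. -/
noncomputable def evaluationLeftAdjointCompEvaluationIso (i j : J) :
    evaluationLeftAdjoint E i ⋙ (evaluation J E).obj j ≅
      Functor.const (Discrete (i ⟶ j)) ⋙ colim :=
  NatIso.ofComponents (fun X => HasColimit.isoOfNatIso (Discrete.natIso (fun _ => Iso.refl _)))
    (fun {X Y} f => by
      refine colimit.hom_ext fun ⟨p⟩ => ?_
      have h1 : Sigma.ι (fun _ : i ⟶ j => X) p ≫
          Limits.Sigma.desc (fun h : i ⟶ j => f ≫ Sigma.ι (fun _ => Y) h) =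
          f ≫ Sigma.ι (fun _ : i ⟶ j => Y) p := by simp
      have h2 : ∀ Z : E, Sigma.ι (fun _ : i ⟶ j => Z) p ≫
          (HasColimit.isoOfNatIso (Discrete.natIso (fun _ : Discrete (i ⟶ j) => Iso.refl Z)) :
            (∐ fun _ : i ⟶ j => Z) ≅ colimit ((Functor.const (Discrete (i ⟶ j))).obj Z)).hom =
          colimit.ι ((Functor.const (Discrete (i ⟶ j))).obj Z) ⟨p⟩ := fun Z =>
        (HasColimit.isoOfNatIso_ι_hom _ _).trans (Category.id_comp _)
      dsimp
      erw [reassoc_of% h1, h2, reassoc_of% (h2 X), ι_colimMap]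
      rfl)

instance evaluationLeftAdjoint_preservesFiniteLimits
    [∀ i j : J, HasExactColimitsOfShape (Discrete (i ⟶ j)) E] (i : J) :
    PreservesFiniteLimits (evaluationLeftAdjoint E i) where
  preservesFiniteLimits _ _ _ := preservesLimitsOfShape_of_evaluation _ _ (fun j =>
    preservesLimitsOfShape_of_natIso (evaluationLeftAdjointCompEvaluationIso i j).symm)

/-- The left adjoint of the evaluation at `i` of complexes of functors. -/
noncomputable abbrev indC (i : J) : CochainComplex E ℤ ⥤ CochainComplex (J ⥤ E) ℤ :=
  (evaluationLeftAdjoint E i).mapHomologicalComplex (.up ℤ)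

/-- The adjunction between induction and evaluation for complexes of functors. -/
noncomputable def indCAdj (i : J) : indC (E := E) i ⊣ evC i :=
  adjunctionOnComplexes (evaluationAdjunctionRight E i) _

/-- The inclusion in an induced complex of the copy of `M` attached to the morphism `p`. -/
noncomputable def indι (i : J) (M : CochainComplex E ℤ) (n : ℤ) {j : J} (p : i ⟶ j) :
    M.X n ⟶ (((indC i).obj M).X n).obj j :=
  Sigma.ι (fun _ : i ⟶ j => M.X n) p

lemma indCAdj_unit_app_f (i : J) (M : CochainComplex E ℤ) (n : ℤ) :
    ((indCAdj i).unit.app M).f n = indι i M n (𝟙 i) :=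
  evaluationAdjunctionRight_unit_app _ _ _

lemma indι_map (i : J) (M : CochainComplex E ℤ) (n : ℤ) {j : J} (p : i ⟶ j) :
    indι i M n (𝟙 i) ≫ (((indC i).obj M).X n).map p = indι i M n p :=
  (Sigma.ι_desc _ _).trans (by rw [Category.id_comp]; rfl)

lemma indC_hom_ext {i : J} {M : CochainComplex E ℤ} {n : ℤ} {j : J} {Z : E}
    {f g : (((indC i).obj M).X n).obj j ⟶ Z}
    (h : ∀ p : i ⟶ j, indι i M n p ≫ f = indι i M n p ≫ g) : f = g :=
  Sigma.hom_ext (f := fun _ : i ⟶ j => M.X n) _ _ h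

lemma exists_indC_desc {i : J} {M : CochainComplex E ℤ} {n : ℤ} {j : J} {Z : E}
    (g : (i ⟶ j) → (M.X n ⟶ Z)) :
    ∃ f : (((indC i).obj M).X n).obj j ⟶ Z, ∀ p, indι i M n p ≫ f = g p :=
  ⟨(Limits.Sigma.desc g : (∐ fun _ : i ⟶ j => M.X n) ⟶ Z), fun _ => Sigma.ι_desc _ _⟩

section Biproducts

variable {C D : Type*} [Category* C] [Preadditive C] [HasFiniteBiproducts C]
  [Category* D] [Preadditive D] (T : C ⥤ D) [T.Additive] {S : Type*} [Finite S] {X : S → C}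

lemma biproduct_sum_π_ι [Fintype S] : ∑ s, biproduct.π X s ≫ biproduct.ι X s = 𝟙 (⨁ X) := by
  classical
  refine biproduct.hom_ext' _ _ (fun s => ?_)
  rw [Preadditive.comp_sum, Finset.sum_eq_single s]
  · rw [← Category.assoc, biproduct.ι_π_self, Category.id_comp, Category.comp_id]
  · intro s' _ h
    rw [← Category.assoc, biproduct.ι_π_ne _ h.symm, zero_comp]
  · simp

variable {T} in
lemma map_biproduct_hom_ext {Z : D} {f g : T.obj (⨁ X) ⟶ Z}
    (h : ∀ s, T.map (biproduct.ι X s) ≫ f = T.map (biproduct.ι X s) ≫ g) : f = g := by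
  have := Fintype.ofFinite S
  have htot : ∑ s, T.map (biproduct.π X s) ≫ T.map (biproduct.ι X s) = 𝟙 _ := by
    simp only [← T.map_comp]
    rw [← T.map_sum, biproduct_sum_π_ι, T.map_id]
  rw [← Category.id_comp f, ← Category.id_comp g, ← htot]
  simp only [Preadditive.sum_comp, Category.assoc, h]

lemma exists_map_biproduct_desc {Z : D} (g : ∀ s, T.obj (X s) ⟶ Z) :
    ∃ f : T.obj (⨁ X) ⟶ Z, ∀ s, T.map (biproduct.ι X s) ≫ f = g s := by
  classical
  have := Fintype.ofFinite S
  refine ⟨∑ s, T.map (biproduct.π X s) ≫ g s, fun s => ?_⟩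
  rw [Preadditive.comp_sum, Finset.sum_eq_single s]
  · rw [← Category.assoc, ← T.map_comp, biproduct.ι_π_self, T.map_id, Category.id_comp]
  · intro s' _ h
    rw [← Category.assoc, ← T.map_comp, biproduct.ι_π_ne _ h.symm, T.map_zero, zero_comp]
  · simp

end Biproducts

instance hasFiniteBiproducts_complexes : HasFiniteBiproducts (CochainComplex (J ⥤ E) ℤ) :=
  HasFiniteBiproducts.of_hasFiniteProducts

variable {S : Type*} [Finite S] (τ : S → J) (M : S → CochainComplex E ℤ)

/-- The complex of functors which is freely generated by a finite family of complexes `M s` placed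
at the objects `τ s`. -/
noncomputable def freeC : CochainComplex (J ⥤ E) ℤ :=
  ⨁ fun s => (indC (τ s)).obj (M s)

/-- The inclusion of a summand of a free complex of functors. -/
noncomputable def freeInc (s : S) : (indC (τ s)).obj (M s) ⟶ freeC τ M :=
  biproduct.ι (fun s => (indC (τ s)).obj (M s)) s

/-- The inclusion of the generators. -/
noncomputable def freeUnit (s : S) : M s ⟶ (evC (τ s)).obj (freeC τ M) :=
  (indCAdj (τ s)).unit.app (M s) ≫
    (evC (τ s)).map (freeInc τ M s)

/-- The translate of a generator by a morphism of `J`. -/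
noncomputable def freeι (s : S) (n : ℤ) {j : J} (p : τ s ⟶ j) :
    (M s).X n ⟶ ((freeC τ M).X n).obj j :=
  (freeUnit τ M s).f n ≫ ((freeC τ M).X n).map p

lemma freeι_map (s : S) (n : ℤ) {j j' : J} (p : τ s ⟶ j) (q : j ⟶ j') :
    freeι τ M s n p ≫ ((freeC τ M).X n).map q = freeι τ M s n (p ≫ q) :=
  (Category.assoc _ _ _).trans ((freeUnit τ M s).f n ≫= (((freeC τ M).X n).map_comp p q).symm)

lemma freeι_id (s : S) (n : ℤ) : freeι τ M s n (𝟙 _) = (freeUnit τ M s).f n :=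
  ((freeUnit τ M s).f n ≫= ((freeC τ M).X n).map_id _).trans (Category.comp_id _)

lemma freeι_eq (s : S) (n : ℤ) {j : J} (p : τ s ⟶ j) :
    freeι τ M s n p = indι (τ s) (M s) n p ≫
      ((freeInc τ M s).f n).app j := by
  have h := ((freeInc τ M s).f n).naturality p
  rw [← indι_map, Category.assoc]
  refine Eq.trans ?_ (indι (τ s) (M s) n (𝟙 _) ≫= h.symm)
  refine Eq.trans ?_ (Category.assoc (indι (τ s) (M s) n (𝟙 _))
    (((freeInc τ M s).f n).app (τ s)) (((freeC τ M).X n).map p))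
  exact congrArg (· ≫ ((freeC τ M).X n).map p) (congrArg
    (· ≫ ((freeInc τ M s).f n).app (τ s))
      (indCAdj_unit_app_f (τ s) (M s) n))

variable (J E) in
/-- The functor which sends a complex of functors to its component of degree `n` at `j : J`. -/
abbrev evalAt (n : ℤ) (j : J) : CochainComplex (J ⥤ E) ℤ ⥤ E :=
  HomologicalComplex.eval (J ⥤ E) (.up ℤ) n ⋙ (evaluation J E).obj j

variable {τ M} in
/-- In each degree and at each object, a free complex is the direct sum of the translates of its
generators. -/
lemma freeC_hom_ext {n : ℤ} {j : J} {Z : E} {f g : ((freeC τ M).X n).obj j ⟶ Z}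
    (h : ∀ (s : S) (p : τ s ⟶ j), freeι τ M s n p ≫ f = freeι τ M s n p ≫ g) : f = g := by
  refine map_biproduct_hom_ext (T := evalAt J E n j)
    (X := fun s => (indC (τ s)).obj (M s)) (fun s => ?_)
  refine indC_hom_ext (fun p => ?_)
  have := h s p
  rw [freeι_eq] at this
  exact (Category.assoc _ _ _).symm.trans (this.trans (Category.assoc _ _ _))

lemma exists_freeC_desc {n : ℤ} {j : J} {Z : E} (g : ∀ (s : S) (_ : τ s ⟶ j), (M s).X n ⟶ Z) :
    ∃ f : ((freeC τ M).X n).obj j ⟶ Z, ∀ (s : S) (p : τ s ⟶ j), freeι τ M s n p ≫ f = g s p := by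
  choose g' hg' using fun s => exists_indC_desc (M := M s) (g s)
  obtain ⟨f, hf⟩ := exists_map_biproduct_desc (evalAt J E n j)
    (X := fun s => (indC (τ s)).obj (M s)) g'
  refine ⟨f, fun s p => ?_⟩
  rw [freeι_eq]
  exact (Category.assoc _ _ _).trans ((indι (τ s) (M s) n p ≫= hf s).trans (hg' s p))

end Induction

section FreeDesc

variable {J : Type*} [Category* J] {E : Type*} [Category* E] [Abelian E]
  [∀ i j : J, HasCoproductsOfShape (i ⟶ j) E]
  {S : Type*} [Finite S] {τ : S → J} {M : S → CochainComplex E ℤ}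

/-- The morphism from a free complex of functors given by the images of the generators. -/
noncomputable def freeDesc {Y : CochainComplex (J ⥤ E) ℤ} (f : ∀ s, M s ⟶ (evC (τ s)).obj Y) :
    freeC τ M ⟶ Y :=
  biproduct.desc (fun s => ((indCAdj (τ s)).homEquiv _ _).symm (f s))

lemma freeUnit_freeDesc {Y : CochainComplex (J ⥤ E) ℤ} (f : ∀ s, M s ⟶ (evC (τ s)).obj Y) (s : S) :
    freeUnit τ M s ≫ (evC (τ s)).map (freeDesc f) = f s := by
  have h : freeInc τ M s ≫ freeDesc f =
    ((indCAdj (τ s)).homEquiv _ _).symm (f s) := biproduct.ι_desc _ _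
  rw [freeUnit, Category.assoc, ← Functor.map_comp, h, ← Adjunction.homEquiv_unit,
    Equiv.apply_symm_apply]

lemma freeι_freeDesc {Y : CochainComplex (J ⥤ E) ℤ} (f : ∀ s, M s ⟶ (evC (τ s)).obj Y) (s : S)
    (n : ℤ) {j : J} (p : τ s ⟶ j) :
    freeι τ M s n p ≫ ((freeDesc f).f n).app j = (f s).f n ≫ (Y.X n).map p := by
  have h := HomologicalComplex.congr_hom (freeUnit_freeDesc f s) n
  rw [← h, freeι]
  exact (Category.assoc _ _ _).trans (((freeUnit τ M s).f n ≫=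
    ((freeDesc f).f n).naturality p).trans (Category.assoc _ _ _).symm)

lemma freeC_complex_hom_ext {Y : CochainComplex (J ⥤ E) ℤ} {f g : freeC τ M ⟶ Y}
    (h : ∀ s, freeUnit τ M s ≫ (evC (τ s)).map f = freeUnit τ M s ≫ (evC (τ s)).map g) :
    f = g := by
  ext n j
  refine freeC_hom_ext (fun s p => ?_)
  have h1 := HomologicalComplex.congr_hom (h s) n
  have h2 : ∀ f : freeC τ M ⟶ Y, freeι τ M s n p ≫ (f.f n).app j =
      (freeUnit τ M s ≫ (evC (τ s)).map f).f n ≫ (Y.X n).map p := fun f =>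
    (Category.assoc _ _ _).trans (((freeUnit τ M s).f n ≫=
      (f.f n).naturality p).trans (Category.assoc _ _ _).symm)
  rw [h2, h2, h s]

end FreeDesc

lemma shortExact_of_evaluation {J : Type*} [Category* J] {E : Type*} [Category* E] [Abelian E]
    (T : ShortComplex (J ⥤ E)) (h : ∀ j, (T.map ((evaluation J E).obj j)).ShortExact) :
    T.ShortExact := by
  have : Mono T.f := by
    have : ∀ j, Mono (T.f.app j) := fun j => (h j).mono_f
    exact NatTrans.mono_of_mono_app _
  have : Epi T.g := by
    have : ∀ j, Epi (T.g.app j) := fun j => (h j).epi_g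
    exact NatTrans.epi_of_epi_app _
  refine ShortComplex.ShortExact.mk ?_
  rw [ShortComplex.exact_iff_isZero_homology]
  refine (Functor.isZero_iff _).2 (fun j => ?_)
  exact ((T.map ((evaluation J E).obj j)).exact_iff_isZero_homology.1 (h j).exact).of_iso
    (T.mapHomologyIso ((evaluation J E).obj j)).symm

/-! ### The standard resolution of a representation -/

section StandardResolution

variable {V : Type*} [Quiver V] [Finite V] [∀ i j : V, Finite (i ⟶ j)]
  {E : Type*} [Category* E] [Abelian E] [∀ i j : Paths V, HasCoproductsOfShape (i ⟶ j) E]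

instance finite_paths : Finite (Paths V) := inferInstanceAs (Finite V)

instance finite_total : Finite (Quiver.Total V) :=
  Finite.of_surjective (α := Σ s t : V, s ⟶ t) (fun x => ⟨x.1, x.2.1, x.2.2⟩)
    (fun a => ⟨⟨a.left, a.right, a.hom⟩, rfl⟩)

variable (W : CochainComplex (Paths V ⥤ E) ℤ)

/-- The sum over the vertices `i` of the complexes freely generated by `W i` at `i`. -/
noncomputable abbrev vertexC : CochainComplex (Paths V ⥤ E) ℤ :=
  freeC (fun i : Paths V => i) (fun i => (evC i).obj W)

/-- The sum over the arrows `a` of the complexes freely generated by `W a.src` at `a.tgt`. -/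
noncomputable abbrev arrowC : CochainComplex (Paths V ⥤ E) ℤ :=
  freeC (fun a : Quiver.Total V => a.tgt) (fun a => (evC a.src).obj W)

/-- The inclusion of the generators of `vertexC W`. -/
noncomputable abbrev vertexUnit (i : Paths V) : (evC i).obj W ⟶ (evC i).obj (vertexC W) :=
  freeUnit (fun i : Paths V => i) (fun i => (evC i).obj W) i

/-- The inclusion of the generators of `arrowC W`. -/
noncomputable abbrev arrowUnit (a : Quiver.Total V) :
    (evC a.src).obj W ⟶ (evC a.tgt).obj (arrowC W) :=
  freeUnit (fun a : Quiver.Total V => a.tgt) (fun a => (evC a.src).obj W) a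

/-- The differential of the standard resolution of a representation: on the generators, it
is the commutator of the inclusion of the generators of `vertexC W` with the arrows. -/
noncomputable def stdD : arrowC W ⟶ vertexC W :=
  freeDesc (fun a : Quiver.Total V => vertexUnit W a.src ≫ evCMap (vertexC W) a.arrow -
    evCMap W a.arrow ≫ vertexUnit W a.tgt)

/-- The augmentation of the standard resolution. -/
noncomputable def stdπ : vertexC W ⟶ W :=
  freeDesc (fun i : Paths V => 𝟙 ((evC i).obj W))

lemma arrowUnit_stdD (a : Quiver.Total V) :
    arrowUnit W a ≫ (evC a.tgt).map (stdD W) =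
      vertexUnit W a.src ≫ evCMap (vertexC W) a.arrow -
        evCMap W a.arrow ≫ vertexUnit W a.tgt :=
  freeUnit_freeDesc _ _

lemma vertexUnit_stdπ (i : Paths V) : vertexUnit W i ≫ (evC i).map (stdπ W) = 𝟙 _ :=
  freeUnit_freeDesc _ _

lemma stdD_stdπ : stdD W ≫ stdπ W = 0 := by
  refine freeC_complex_hom_ext (fun a => ?_)
  rw [Functor.map_comp, Functor.map_zero, comp_zero]
  have := arrowUnit_stdD W a
  rw [← Category.assoc]
  refine (congrArg (· ≫ (evC a.tgt).map (stdπ W)) this).trans ?_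
  rw [Preadditive.sub_comp, Category.assoc, Category.assoc, vertexUnit_stdπ,
    ← evC_map_evCMap, reassoc_of% vertexUnit_stdπ, Category.comp_id, sub_self]

/-- The copy of `W i` in the value of `vertexC W` at `j` attached to a path. -/
noncomputable def vertexι (n : ℤ) {i j : Paths V} (p : i ⟶ j) :
    (W.X n).obj i ⟶ ((vertexC W).X n).obj j :=
  freeι (fun i : Paths V => i) (fun i => (evC i).obj W) i n p

/-- The copy of `W a.src` in the value of `arrowC W` at `j` attached to a path. -/
noncomputable def arrowι (n : ℤ) (a : Quiver.Total V) {j : Paths V} (p : a.tgt ⟶ j) :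
    (W.X n).obj a.src ⟶ ((arrowC W).X n).obj j :=
  freeι (fun a : Quiver.Total V => a.tgt) (fun a => (evC a.src).obj W) a n p

lemma vertexι_map (n : ℤ) {i j j' : Paths V} (p : i ⟶ j) (q : j ⟶ j') :
    vertexι W n p ≫ ((vertexC W).X n).map q = vertexι W n (p ≫ q) :=
  freeι_map _ _ _ _ _ _

lemma arrowι_map (n : ℤ) (a : Quiver.Total V) {j j' : Paths V} (p : a.tgt ⟶ j) (q : j ⟶ j') :
    arrowι W n a p ≫ ((arrowC W).X n).map q = arrowι W n a (p ≫ q) :=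
  freeι_map _ _ _ _ _ _

lemma vertexι_id (n : ℤ) (i : Paths V) : vertexι W n (𝟙 i) = (vertexUnit W i).f n :=
  freeι_id _ _ _ _

lemma vertexι_stdπ (n : ℤ) {i j : Paths V} (p : i ⟶ j) :
    vertexι W n p ≫ ((stdπ W).f n).app j = (W.X n).map p :=
  (freeι_freeDesc _ _ _ _).trans (Category.id_comp _)

lemma arrowι_stdD (n : ℤ) (a : Quiver.Total V) {j : Paths V} (p : a.tgt ⟶ j) :
    arrowι W n a p ≫ ((stdD W).f n).app j =
      vertexι W n (a.arrow ≫ p) - (W.X n).map a.arrow ≫ vertexι W n p := by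
  refine (freeι_freeDesc _ _ _ _).trans ?_
  have h1 : (W.X n).map a.arrow ≫ vertexι W n (𝟙 _) ≫ ((vertexC W).X n).map p =
      (W.X n).map a.arrow ≫ vertexι W n p := by
    rw [vertexι_map, Category.id_comp]
  have h2 : (vertexι W n a.arrow - (W.X n).map a.arrow ≫ vertexι W n (𝟙 _)) ≫
      ((vertexC W).X n).map p =
      vertexι W n (a.arrow ≫ p) - (W.X n).map a.arrow ≫ vertexι W n p := by
    rw [Preadditive.sub_comp, vertexι_map, Category.assoc, h1]
  rw [vertexι_id] at h2
  exact h2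

/-- The component, on the copy of `W i` attached to a path `p`, of the retraction of the standard
resolution: it is the sum, over the decompositions `p = q ≫ a ≫ q'` with `a` an arrow, of the action
of `q` followed by the inclusion of the copy attached to `(a, q')`. -/
noncomputable def pathRetraction (n : ℤ) {i : V} : ∀ {j : V} (_ : Quiver.Path i j),
    ((W.X n).obj (i : Paths V) ⟶ ((arrowC W).X n).obj (j : Paths V))
  | _, .nil => 0
  | _, .cons (b := s) (c := t) p b =>
      let a : Quiver.Total V := ⟨s, t, b⟩
      pathRetraction n p ≫ ((arrowC W).X n).map a.arrow +
        (W.X n).map (show @Quiver.Hom (Paths V) _ i a.src from p) ≫ arrowι W n a (𝟙 a.tgt)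

lemma pathRetraction_id (n : ℤ) (i : Paths V) :
    pathRetraction W n (𝟙 i : i ⟶ i) = 0 := rfl

lemma pathRetraction_comp (n : ℤ) {i : Paths V} (a : Quiver.Total V) (p : i ⟶ a.src) :
    pathRetraction W n (p ≫ a.arrow) =
      pathRetraction W n p ≫ ((arrowC W).X n).map a.arrow +
        (W.X n).map p ≫ arrowι W n a (𝟙 a.tgt) := rfl

/-- Induction on paths, adding arrows on the right. -/
lemma path_induction {i : Paths V} {P : ∀ {j : Paths V}, (i ⟶ j) → Prop} (h0 : P (𝟙 i))
    (h1 : ∀ (a : Quiver.Total V) (p : i ⟶ a.src), P p → P (p ≫ a.arrow))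
    {j : Paths V} (p : i ⟶ j) : P p :=
  Paths.induction_fixed_source P h0 (fun {s t} p b hp => h1 ⟨s, t, b⟩ p hp) p

/-- `pathRetraction` is a retraction of the differential of the standard resolution. -/
lemma pathRetraction_arrow_comp (n : ℤ) (a : Quiver.Total V) {j : Paths V} (p : a.tgt ⟶ j) :
    pathRetraction W n (a.arrow ≫ p) - (W.X n).map a.arrow ≫ pathRetraction W n p =
      arrowι W n a p := by
  induction p using path_induction with
  | h0 =>
    have h := pathRetraction_comp W n a (𝟙 a.src)
    rw [Category.id_comp] at h
    rw [Category.comp_id, h]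
    simp [pathRetraction_id]
  | h1 b p ih =>
    rw [← Category.assoc, pathRetraction_comp, pathRetraction_comp, Preadditive.comp_add,
      add_sub_add_comm, Functor.map_comp, Category.assoc, sub_self, add_zero,
      ← Category.assoc, ← Preadditive.sub_comp, ih]
    exact arrowι_map W n a p b.arrow

/-- The identity of the middle term of the standard resolution, decomposed by `pathRetraction`
and the section given by the trivial path. -/
lemma pathRetraction_stdD (n : ℤ) {i j : Paths V} (p : i ⟶ j) :
    pathRetraction W n p ≫ ((stdD W).f n).app j + (W.X n).map p ≫ vertexι W n (𝟙 j) =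
      vertexι W n p := by
  induction p using path_induction with
  | h0 => simp [pathRetraction_id]
  | h1 a p ih =>
    rw [pathRetraction_comp, Preadditive.add_comp, Category.assoc, Category.assoc, arrowι_stdD,
      NatTrans.naturality, ← Category.assoc, eq_sub_of_add_eq ih, Category.comp_id,
      Preadditive.sub_comp, Preadditive.comp_sub, Functor.map_comp, Category.assoc, Category.assoc]
    rw [vertexι_map, vertexι_map, Category.id_comp]
    abel

/-- The standard resolution of a complex of representations of a quiver. -/
noncomputable def stdShortComplex : ShortComplex (CochainComplex (Paths V ⥤ E) ℤ) :=
  ShortComplex.mk (stdD W) (stdπ W) (stdD_stdπ W)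

/-- The standard resolution is split in each degree and at each vertex. -/
lemma nonempty_splitting_stdShortComplex (n : ℤ) (j : Paths V) :
    Nonempty ((stdShortComplex W).map (evalAt (Paths V) E n j)).Splitting := by
  obtain ⟨r, hr⟩ := exists_freeC_desc (fun i : Paths V => i) (fun i => (evC i).obj W)
    (n := n) (j := j) (fun i p => pathRetraction W n p)
  refine ⟨{ r := r, s := vertexι W n (𝟙 j), f_r := ?_, s_g := ?_, id := ?_ }⟩
  · refine freeC_hom_ext (fun a p => ?_)
    have h := arrowι_stdD W n a p
    refine (Category.assoc _ _ _).symm.trans ((congrArg (· ≫ r) h).trans ?_)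
    have h2 : (vertexι W n (a.arrow ≫ p) - (W.X n).map a.arrow ≫ vertexι W n p) ≫ r =
        arrowι W n a p := by
      rw [← pathRetraction_arrow_comp, Preadditive.sub_comp, Category.assoc]
      exact congrArg₂ (· - ·) (hr _ _) (_ ≫= hr _ _)
    exact h2.trans (Category.comp_id _).symm
  · exact (vertexι_stdπ W n (𝟙 j)).trans ((W.X n).map_id j)
  · refine freeC_hom_ext (fun i p => ?_)
    refine (Preadditive.comp_add _ _ _ _ _ _).trans (Eq.trans ?_ (Category.comp_id _).symm)
    refine Eq.trans (congrArg₂ (· + ·) ?_ ?_) (pathRetraction_stdD W n p)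
    · exact (Category.assoc _ _ _).symm.trans (congrArg (· ≫ ((stdD W).f n).app j) (hr i p))
    · exact (Category.assoc _ _ _).symm.trans
        (congrArg (· ≫ vertexι W n (𝟙 j)) (vertexι_stdπ W n p))

lemma stdShortComplex_shortExact : (stdShortComplex W).ShortExact :=
  HomologicalComplex.shortExact_of_degreewise_shortExact _ (fun n =>
    shortExact_of_evaluation _ (fun j =>
      (nonempty_splitting_stdShortComplex W n j).some.shortExact))

end StandardResolution

/-! ### Evaluation and induction on derived categories -/

section EvaluationOnDerivedCategory

open DerivedCategory

variable {J : Type*} [Category* J] {E : Type*} [Category* E] [Abelian E]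
  [HasDerivedCategory E] [HasDerivedCategory (J ⥤ E)]

/-- The evaluation at `i : J` of a morphism in the derived category of `J ⥤ E`, as a morphism
between the classes of the evaluated complexes. -/
noncomputable def evQ (i : J) {W Z : CochainComplex (J ⥤ E) ℤ} (φ : Q.obj W ⟶ Q.obj Z) :
    Q.obj ((evC i).obj W) ⟶ Q.obj ((evC i).obj Z) :=
  (((evaluation J E).obj i).mapDerivedCategoryFactors.inv.app W ≫
    ((evaluation J E).obj i).mapDerivedCategory.map φ ≫
      ((evaluation J E).obj i).mapDerivedCategoryFactors.hom.app Z)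

lemma evQ_Q_map (i : J) {W Z : CochainComplex (J ⥤ E) ℤ} (f : W ⟶ Z) :
    evQ i (Q.map f) = Q.map ((evC i).map f) := by
  have h : ((evaluation J E).obj i).mapDerivedCategoryFactors.inv.app W ≫
      ((evaluation J E).obj i).mapDerivedCategoryFactors.hom.app W = 𝟙 _ := Iso.inv_hom_id_app _ _
  refine (((_ ≫= ((evaluation J E).obj i).mapDerivedCategoryFactors.hom.naturality f).trans
    (Category.assoc _ _ _).symm).trans (congrArg (· ≫ Q.map ((evC i).map f)) h)).trans
      (Category.id_comp _)

lemma evQ_comp (i : J) {W Z T : CochainComplex (J ⥤ E) ℤ} (φ : Q.obj W ⟶ Q.obj Z)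
    (ψ : Q.obj Z ⟶ Q.obj T) : evQ i (φ ≫ ψ) = evQ i φ ≫ evQ i ψ := by
  have h : ((evaluation J E).obj i).mapDerivedCategoryFactors.hom.app Z ≫
    ((evaluation J E).obj i).mapDerivedCategoryFactors.inv.app Z = 𝟙 _ := Iso.hom_inv_id_app _ _
  simp only [evQ, Functor.map_comp, Category.assoc]
  rw [reassoc_of% h]

lemma evQ_id (i : J) (W : CochainComplex (J ⥤ E) ℤ) : evQ i (𝟙 (Q.obj W)) = 𝟙 _ := by
  rw [← Q.map_id, evQ_Q_map, CategoryTheory.Functor.map_id, Q.map_id]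

lemma evQ_sub (i : J) {W Z : CochainComplex (J ⥤ E) ℤ} (φ ψ : Q.obj W ⟶ Q.obj Z) :
    evQ i (φ - ψ) = evQ i φ - evQ i ψ := by
  simp [evQ, Functor.map_sub]

lemma evQ_zero (i : J) (W Z : CochainComplex (J ⥤ E) ℤ) :
    evQ i (0 : Q.obj W ⟶ Q.obj Z) = 0 := by
  simp [evQ]

/-- The vertex components of a morphism in the derived category of functors are natural, although
the derived category of functors is not the category of functors to the derived category. -/
lemma evQ_naturality {W Z : CochainComplex (J ⥤ E) ℤ} (φ : Q.obj W ⟶ Q.obj Z) {i j : J}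
    (a : i ⟶ j) : evQ i φ ≫ Q.map (evCMap Z a) = Q.map (evCMap W a) ≫ evQ j φ := by
  obtain ⟨T, s, hs, g, rfl⟩ := right_fac φ
  have h (i : J) : IsIso (Q.map ((evC i).map s)) := by
    rw [isIso_Q_map_iff_quasiIso] at hs ⊢
    exact (HomologicalComplex.quasiIso_iff_evaluation s).1 hs i
  have h' (i : J) : evQ i (inv (Q.map s)) = inv (Q.map ((evC i).map s)) := by
    refine IsIso.eq_inv_of_hom_inv_id ?_
    rw [← evQ_Q_map, ← evQ_comp, IsIso.hom_inv_id, evQ_id]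
  rw [evQ_comp, evQ_comp, h', h', evQ_Q_map, evQ_Q_map, Category.assoc, IsIso.inv_comp_eq,
    ← Q.map_comp, evC_map_evCMap, ← Category.assoc, ← Category.assoc, ← Q.map_comp,
    evC_map_evCMap, Q.map_comp, Q.map_comp, Category.assoc, Category.assoc, IsIso.hom_inv_id_assoc]

/-- Evaluations jointly reflect isomorphisms in the derived category. -/
lemma isIso_of_evQ {W Z : CochainComplex (J ⥤ E) ℤ} (φ : Q.obj W ⟶ Q.obj Z)
    (h : ∀ i, IsIso (evQ i φ)) : IsIso φ := by
  obtain ⟨T, s, hs, g, rfl⟩ := right_fac φ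
  suffices IsIso (Q.map g) from inferInstance
  rw [isIso_Q_map_iff_quasiIso, HomologicalComplex.quasiIso_iff_evaluation]
  intro i
  rw [← isIso_Q_map_iff_quasiIso]
  have := h i
  have hs' : IsIso (evQ i (Q.map s)) := by
    rw [evQ_Q_map, isIso_Q_map_iff_quasiIso]
    rw [isIso_Q_map_iff_quasiIso] at hs
    exact (HomologicalComplex.quasiIso_iff_evaluation s).1 hs i
  have h2 : Q.map ((evC i).map g) = evQ i (Q.map s) ≫ evQ i (inv (Q.map s) ≫ Q.map g) := by
    rw [← evQ_comp, IsIso.hom_inv_id_assoc, evQ_Q_map]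
  have h3 : IsIso (Q.map ((evC i).map g)) := h2 ▸ inferInstance
  exact h3

end EvaluationOnDerivedCategory

section InductionOnDerivedCategory

open DerivedCategory

variable {J : Type*} [Category* J] {E : Type*} [Category* E] [Abelian E]
  [HasDerivedCategory E] [HasDerivedCategory (J ⥤ E)]
  [∀ i j : J, HasCoproductsOfShape (i ⟶ j) E]
  [∀ i j : J, HasExactColimitsOfShape (Discrete (i ⟶ j)) E]

/-- As induction and evaluation are exact, the adjunction between them passes to the derived
categories. -/
lemma bijective_unit_comp_evQ (i : J) (M : CochainComplex E ℤ) (Z : CochainComplex (J ⥤ E) ℤ) :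
    Function.Bijective (fun φ : Q.obj ((indC i).obj M) ⟶ Q.obj Z =>
      Q.map ((indCAdj i).unit.app M) ≫ evQ i φ) := by
  let G := evaluationLeftAdjoint E i
  let R := (evaluation J E).obj i
  let : CatCommSq (indC (E := E) i) Q Q G.mapDerivedCategory :=
    ⟨G.mapDerivedCategoryFactors.symm⟩
  let : CatCommSq (evC (E := E) i) Q Q R.mapDerivedCategory :=
    ⟨R.mapDerivedCategoryFactors.symm⟩
  let adj := (indCAdj (E := E) i).localization Q (HomologicalComplex.quasiIso E (.up ℤ)) Q
    (HomologicalComplex.quasiIso (J ⥤ E) (.up ℤ)) G.mapDerivedCategory R.mapDerivedCategory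
  have h : (fun φ : Q.obj ((indC i).obj M) ⟶ Q.obj Z =>
      Q.map ((indCAdj i).unit.app M) ≫ evQ i φ) =
      (((G.mapDerivedCategoryFactors.app M).homFromEquiv (Z := Q.obj Z)).symm.trans
        ((adj.homEquiv (Q.obj M) (Q.obj Z)))).trans
          (R.mapDerivedCategoryFactors.app Z).homToEquiv := by
    ext φ
    have h1 : adj.unit.app (Q.obj M) = Q.map ((indCAdj i).unit.app M) ≫
      R.mapDerivedCategoryFactors.inv.app _ ≫
        R.mapDerivedCategory.map (G.mapDerivedCategoryFactors.inv.app M) :=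
      Adjunction.localization_unit_app _ _ _ _ _ _ _ _
    simp only [Equiv.trans_apply, Adjunction.homEquiv_unit, h1]
    simp only [Iso.homFromEquiv, Iso.homToEquiv, evQ]
    have h2 : G.mapDerivedCategoryFactors.inv.app M ≫ G.mapDerivedCategoryFactors.hom.app M =
      𝟙 _ := Iso.inv_hom_id_app _ _
    have h3 := congrArg R.mapDerivedCategory.map h2
    rw [Functor.map_comp, CategoryTheory.Functor.map_id] at h3
    dsimp
    simp only [Functor.map_comp, Category.assoc]
    rw [reassoc_of% h3]
  rw [h]
  exact Equiv.bijective _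

variable {S : Type*} [Finite S] {τ : S → J} {M : S → CochainComplex E ℤ}
  {Z : CochainComplex (J ⥤ E) ℤ}

lemma freeUnit_comp_evQ (φ : Q.obj (freeC τ M) ⟶ Q.obj Z) (s : S) :
    Q.map (freeUnit τ M s) ≫ evQ (τ s) φ =
      Q.map ((indCAdj (τ s)).unit.app (M s)) ≫ evQ (τ s) (Q.map (freeInc τ M s) ≫ φ) := by
  rw [freeUnit, Q.map_comp, evQ_comp, evQ_Q_map, Category.assoc]

/-- The universal property of free complexes, in the derived category. -/
lemma Q_freeC_hom_ext {φ ψ : Q.obj (freeC τ M) ⟶ Q.obj Z}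
    (h : ∀ s, Q.map (freeUnit τ M s) ≫ evQ (τ s) φ = Q.map (freeUnit τ M s) ≫ evQ (τ s) ψ) :
    φ = ψ := by
  refine map_biproduct_hom_ext (T := Q) (X := fun s => (indC (τ s)).obj (M s)) (fun s => ?_)
  refine (bijective_unit_comp_evQ (τ s) (M s) Z).1 ?_
  have := h s
  rwa [freeUnit_comp_evQ, freeUnit_comp_evQ] at this

lemma exists_Q_freeC_desc (g : ∀ s, Q.obj (M s) ⟶ Q.obj ((evC (τ s)).obj Z)) :
    ∃ φ : Q.obj (freeC τ M) ⟶ Q.obj Z, ∀ s, Q.map (freeUnit τ M s) ≫ evQ (τ s) φ = g s := by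
  choose g' hg' using fun s => (bijective_unit_comp_evQ (τ s) (M s) Z).2 (g s)
  obtain ⟨φ, hφ⟩ := exists_map_biproduct_desc Q (X := fun s => (indC (τ s)).obj (M s)) g'
  refine ⟨φ, fun s => (freeUnit_comp_evQ _ s).trans ?_⟩
  rw [← hg' s]
  exact _ ≫= congrArg (evQ (τ s)) (hφ s)

end InductionOnDerivedCategory

/-! ### Cocycles of degree one and connecting morphisms -/

section Cocycles

open CochainComplex.HomComplex DerivedCategory

variable {C : Type*} [Category* C]

section

variable [Preadditive C] {K L : CochainComplex C ℤ}

/-- The morphism to a shifted complex given by a cocycle is homotopic to zero exactly when the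
cocycle is a coboundary. -/
lemma quotient_map_equivHomShift_symm_eq_zero_iff {n m : ℤ} (hm : m + 1 = n) (z : Cocycle K L n) :
    (HomotopyCategory.quotient C (.up ℤ)).map (Cocycle.equivHomShift.symm z) = 0 ↔
      ∃ y : Cochain K L m, δ m n y = z.1 := by
  rw [← CohomologyClass.toHom_mk, CohomologyClass.toHom_mk_eq_zero_iff, mem_coboundaries_iff _ m hm]

lemma equivHomShift_symm_f {n : ℤ} (z : Cocycle K L n) (p : ℤ) :
    (Cocycle.equivHomShift.symm z).f p = z.1.v p (p + n) rfl := by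
  rw [Cocycle.equivHomShift_symm_apply, Cocycle.homOf_f, Cocycle.rightShift_coe,
    Cochain.rightShift_v _ n 0 _ p p _ (p + n) rfl]
  exact Category.comp_id _

lemma map_equivHomShift_symm {D : Type*} [Category* D] [Preadditive D] (T : C ⥤ D) [T.Additive]
    {n : ℤ} (z : Cocycle K L n) :
    (T.mapHomologicalComplex (.up ℤ)).map (Cocycle.equivHomShift.symm z) ≫
      ((T.mapHomologicalComplex (.up ℤ)).commShiftIso n).hom.app L =
    Cocycle.equivHomShift.symm (Cocycle.mk (z.1.map T) (n + 1) rfl (by rw [δ_map]; simp)) := by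
  ext p
  refine (Category.comp_id _).trans ?_
  rw [equivHomShift_symm_f]
  exact congrArg T.map (equivHomShift_symm_f z p)

end

variable [Abelian C] [HasDerivedCategory C] {K L : CochainComplex C ℤ}

lemma Q_map_equivHomShift_symm_eq_zero {n m : ℤ} (hm : m + 1 = n) (z : Cocycle K L n)
    (h : ∃ y : Cochain K L m, δ m n y = z.1) : Q.map (Cocycle.equivHomShift.symm z) = 0 := by
  have h0 := (quotient_map_equivHomShift_symm_eq_zero_iff hm z).2 h
  have h1 := (quotientCompQhIso C).hom.naturality (Cocycle.equivHomShift.symm z)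
  rw [← cancel_epi ((quotientCompQhIso C).hom.app K), ← h1, Functor.comp_map, h0,
    Functor.map_zero, zero_comp, comp_zero]

/-- The connecting morphism of a short exact sequence is computed by means of a cochain `k` on the
middle term which restricts to a morphism of complexes, and whose differential comes from a cocycle
on the third term. -/
lemma triangleOfSESδ_comp_shift_map {S : ShortComplex (CochainComplex C ℤ)} (hS : S.ShortExact)
    {Y : CochainComplex C ℤ} (h : S.X₁ ⟶ Y) (k : Cochain S.X₂ Y 0) (z : Cocycle S.X₃ Y 1)
    (h1 : (Cochain.ofHom S.f).comp k (zero_add 0) = Cochain.ofHom h)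
    (h2 : δ 0 1 k = (Cochain.ofHom S.g).comp z.1 (zero_add 1)) :
    triangleOfSESδ hS ≫ (Q.map h)⟦(1 : ℤ)⟧' =
      - Q.map (Cocycle.equivHomShift.symm z) ≫ (Q.commShiftIso (1 : ℤ)).hom.app Y := by
  let q := CochainComplex.mappingCone.descShortComplex S
  have hq : IsIso (Q.map q) := by
    rw [isIso_Q_map_iff_quasiIso]
    exact CochainComplex.mappingCone.quasiIso_descShortComplex hS
  let t : Cocycle (CochainComplex.mappingCone S.f) S.X₁ 1 := -CochainComplex.mappingCone.fst S.f
  have ht : (CochainComplex.mappingCone.triangle S.f).mor₃ = Cocycle.equivHomShift.symm t := rfl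
  have h3 : Q.map (Cocycle.equivHomShift.symm (t.postcomp h)) +
      Q.map (Cocycle.equivHomShift.symm (z.precomp q)) = 0 := by
    rw [← Q.map_add, ← map_add]
    refine Q_map_equivHomShift_symm_eq_zero (zero_add 1) _
      ⟨(CochainComplex.mappingCone.snd S.f).comp k (add_zero 0), ?_⟩
    have hq' : Cochain.ofHom q =
        (CochainComplex.mappingCone.snd S.f).comp (Cochain.ofHom S.g) (add_zero 0) := by
      ext n
      simp [q, CochainComplex.mappingCone.descShortComplex, CochainComplex.mappingCone.descCochain]
    rw [δ_comp_zero_cochain _ _ _ (zero_add 1), h2, CochainComplex.mappingCone.δ_snd,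
      Cochain.neg_comp, Cochain.comp_assoc_of_third_is_zero_cochain, h1]
    simp [t, hq', Cochain.comp_assoc_of_first_is_zero_cochain, add_comm]
  rw [Cocycle.equivHomShift_symm_postcomp, Cocycle.equivHomShift_symm_precomp, Q.map_comp,
    Q.map_comp, ← ht] at h3
  have h4 := (Q.commShiftIso (1 : ℤ)).hom.naturality h
  rw [← cancel_epi (Q.map q)]
  have h5 := descShortComplex_triangleOfSESδ hS
  refine (Category.assoc _ _ _).symm.trans ((congrArg (· ≫ (Q.map h)⟦(1 : ℤ)⟧') h5).trans ?_)
  refine (Category.assoc _ _ _).trans ((_ ≫= h4.symm).trans ?_)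
  refine (Category.assoc _ _ _).symm.trans ?_
  refine (congrArg (· ≫ (Q.commShiftIso (1 : ℤ)).hom.app Y)
    (eq_neg_of_add_eq_zero_left h3)).trans ?_
  simp

end Cocycles

section FreeCochains

open CochainComplex.HomComplex DerivedCategory

variable {J : Type*} [Category* J] {E : Type*} [Category* E] [Abelian E]
  [∀ i j : J, HasCoproductsOfShape (i ⟶ j) E]
  {S : Type*} [Finite S] {τ : S → J} {M : S → CochainComplex E ℤ} {Y : CochainComplex (J ⥤ E) ℤ}

/-- The restriction of a cochain on a free complex to the generators. -/
noncomputable def freeCochainRestrict {n : ℤ} (k : Cochain (freeC τ M) Y n) (s : S) :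
    Cochain (M s) ((evC (τ s)).obj Y) n :=
  (Cochain.ofHom (freeUnit τ M s)).comp (evCochain (τ s) k) (zero_add n)

lemma freeι_freeCochain_v {n : ℤ} (k : Cochain (freeC τ M) Y n) (s : S) (p q : ℤ)
    (hpq : p + n = q) {j : J} (u : τ s ⟶ j) :
    freeι τ M s p u ≫ (k.v p q hpq).app j =
      (freeCochainRestrict k s).v p q hpq ≫ (Y.X q).map u := by
  have h : (freeCochainRestrict k s).v p q hpq =
      (freeUnit τ M s).f p ≫ (k.v p q hpq).app (τ s) :=
    (Cochain.zero_cochain_comp_v _ _ _ _ _).trans (congrArg (· ≫ _) (Cochain.ofHom_v _ _))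
  rw [h, freeι]
  exact (Category.assoc _ _ _).trans (((freeUnit τ M s).f p ≫=
    (k.v p q hpq).naturality u).trans (Category.assoc _ _ _).symm)

lemma freeCochain_ext {n : ℤ} {k k' : Cochain (freeC τ M) Y n}
    (h : ∀ s, freeCochainRestrict k s = freeCochainRestrict k' s) : k = k' := by
  ext p q hpq j
  refine freeC_hom_ext (fun s u => ?_)
  rw [freeι_freeCochain_v, freeι_freeCochain_v, h]

lemma exists_freeCochain {n : ℤ} (f : ∀ s, Cochain (M s) ((evC (τ s)).obj Y) n) :
    ∃ k : Cochain (freeC τ M) Y n, ∀ s, freeCochainRestrict k s = f s := by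
  choose g hg using fun (p q : ℤ) (hpq : p + n = q) (j : J) =>
    exists_freeC_desc τ M (n := p) (j := j) (fun s u => (f s).v p q hpq ≫ (Y.X q).map u)
  let k : Cochain (freeC τ M) Y n := Cochain.mk (fun p q hpq =>
    { app := fun j => g p q hpq j
      naturality := fun j j' v => by
        refine freeC_hom_ext (fun s u => ?_)
        refine (Category.assoc _ _ _).symm.trans ((congrArg (· ≫ g p q hpq j')
          (freeι_map τ M s p u v)).trans ((hg p q hpq j' s _).trans ?_))
        refine Eq.trans ?_ ((congrArg (· ≫ (Y.X q).map v) (hg p q hpq j s u)).symm.trans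
          (Category.assoc _ _ _))
        exact (_ ≫= (Y.X q).map_comp _ _).trans (Category.assoc _ _ _).symm })
  refine ⟨k, fun s => ?_⟩
  ext p q hpq
  have h1 := freeι_freeCochain_v k s p q hpq (𝟙 _)
  have h2 : freeι τ M s p (𝟙 _) ≫ (k.v p q hpq).app (τ s) =
    (f s).v p q hpq ≫ (Y.X q).map (𝟙 _) := hg p q hpq (τ s) s (𝟙 _)
  rw [h1, CategoryTheory.Functor.map_id] at h2
  exact (Category.comp_id _).symm.trans (h2.trans (Category.comp_id _))

lemma δ_freeCochainRestrict {n m : ℤ} (k : Cochain (freeC τ M) Y n) (s : S) :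
    δ n m (freeCochainRestrict k s) = freeCochainRestrict (δ n m k) s := by
  rw [freeCochainRestrict, δ_ofHom_comp, δ_evCochain]
  rfl

lemma freeCochainRestrict_comp {W : CochainComplex (J ⥤ E) ℤ} {n : ℤ} (f : freeC τ M ⟶ W)
    (k : Cochain W Y n) (s : S) :
    freeCochainRestrict ((Cochain.ofHom f).comp k (zero_add n)) s =
      (Cochain.ofHom (freeUnit τ M s ≫ (evC (τ s)).map f)).comp (evCochain (τ s) k)
        (zero_add n) := by
  ext p q hpq
  simp [freeCochainRestrict]

end FreeCochains

/-! ### The triangle of the standard resolution -/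

section StandardTriangle

open CochainComplex.HomComplex DerivedCategory Pretriangulated

variable {V : Type*} [Quiver V] [Finite V] [∀ i j : V, Finite (i ⟶ j)]
  {E : Type*} [Category* E] [Abelian E] [∀ i j : Paths V, HasCoproductsOfShape (i ⟶ j) E]
  {W Y Z : CochainComplex (Paths V ⥤ E) ℤ}

lemma freeCochainRestrict_stdD_comp {n : ℤ} (k : Cochain (vertexC W) Y n) (a : Quiver.Total V) :
    freeCochainRestrict ((Cochain.ofHom (stdD W)).comp k (zero_add n)) a =
      arrowCommutator (X := W) (Y := Y) (fun i => freeCochainRestrict k i) a := by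
  have h : (Cochain.ofHom (evCMap (vertexC W) a.arrow)).comp (evCochain a.tgt k) (zero_add n) =
      (evCochain a.src k).comp (Cochain.ofHom (evCMap Y a.arrow)) (add_zero n) :=
    (sub_eq_zero.1 (arrowCommutator_evCochain k a)).symm
  refine (freeCochainRestrict_comp _ _ _).trans ?_
  refine (congrArg (fun f => (Cochain.ofHom f).comp (evCochain a.tgt k) (zero_add n))
    (arrowUnit_stdD W a)).trans ?_
  rw [Cochain.ofHom_sub, Cochain.sub_comp, Cochain.ofHom_comp, Cochain.ofHom_comp,
    Cochain.comp_assoc_of_first_is_zero_cochain, h, Cochain.comp_assoc_of_first_is_zero_cochain,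
    ← Cochain.comp_assoc_of_first_is_zero_cochain]
  rfl

lemma freeCochainRestrict_stdπ_comp {n : ℤ} (z : Cochain W Y n) (i : Paths V) :
    freeCochainRestrict ((Cochain.ofHom (stdπ W)).comp z (zero_add n)) i = evCochain i z := by
  refine (freeCochainRestrict_comp _ _ _).trans ?_
  refine (congrArg (fun f => (Cochain.ofHom f).comp (evCochain i z) (zero_add n))
    (vertexUnit_stdπ W i)).trans ?_
  exact Cochain.id_comp _

variable [∀ i j : Paths V, HasExactColimitsOfShape (Discrete (i ⟶ j)) E]
  [HasDerivedCategory E] [HasDerivedCategory (Paths V ⥤ E)]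

lemma arrowUnit_comp_evQ_stdD (φ : Q.obj (vertexC W) ⟶ Q.obj Z) (a : Quiver.Total V) :
    Q.map (arrowUnit W a) ≫ evQ a.tgt (Q.map (stdD W) ≫ φ) =
      (Q.map (vertexUnit W a.src) ≫ evQ a.src φ) ≫ Q.map (evCMap Z a.arrow) -
        Q.map (evCMap W a.arrow) ≫ Q.map (vertexUnit W a.tgt) ≫ evQ a.tgt φ := by
  rw [evQ_comp, evQ_Q_map, ← Category.assoc, ← Q.map_comp, arrowUnit_stdD, Q.map_sub,
    Preadditive.sub_comp, Q.map_comp, Q.map_comp, Category.assoc, Category.assoc, Category.assoc,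
    evQ_naturality]

lemma vertexUnit_comp_evQ_stdπ (φ : Q.obj W ⟶ Q.obj Z) (i : Paths V) :
    Q.map (vertexUnit W i) ≫ evQ i (Q.map (stdπ W) ≫ φ) = evQ i φ := by
  rw [evQ_comp, evQ_Q_map, ← Category.assoc, ← Q.map_comp, vertexUnit_stdπ, Q.map_id,
    Category.id_comp]

/-- A family of morphisms in the derived category of `E` which commute with the arrows comes from
a morphism in the derived category of representations. -/
lemma exists_evQ_eq (u : ∀ i : Paths V, Q.obj ((evC i).obj W) ⟶ Q.obj ((evC i).obj Z))
    (hu : ∀ a : Quiver.Total V, u a.src ≫ Q.map (evCMap Z a.arrow) =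
      Q.map (evCMap W a.arrow) ≫ u a.tgt) :
    ∃ φ : Q.obj W ⟶ Q.obj Z, ∀ i, evQ i φ = u i := by
  obtain ⟨v, hv⟩ := exists_Q_freeC_desc (τ := fun i : Paths V => i)
    (M := fun i => (evC i).obj W) (Z := Z) u
  have h0 : Q.map (stdD W) ≫ v = 0 := by
    refine Q_freeC_hom_ext (fun a => ?_)
    rw [evQ_zero, comp_zero]
    refine (arrowUnit_comp_evQ_stdD v a).trans (sub_eq_zero.2 ?_)
    exact (congrArg (· ≫ Q.map (evCMap Z a.arrow)) (hv a.src)).trans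
      ((hu a).trans (Q.map (evCMap W a.arrow) ≫= (hv a.tgt).symm))
  obtain ⟨φ, hφ⟩ : ∃ φ : Q.obj W ⟶ Q.obj Z, v = Q.map (stdπ W) ≫ φ :=
    Triangle.yoneda_exact₂ _ (triangleOfSES_distinguished (stdShortComplex_shortExact W)) v h0
  refine ⟨φ, fun i => ?_⟩
  rw [← vertexUnit_comp_evQ_stdπ, ← hv i, hφ]

variable (W) in
/-- The connecting morphism of the standard resolution. -/
noncomputable def stdδ : Q.obj W ⟶ (Q.obj (arrowC W))⟦(1 : ℤ)⟧ :=
  triangleOfSESδ (stdShortComplex_shortExact W)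

/-- The relation between cocycles of degree `1` and families of morphisms indexed by the arrows is
given by the connecting morphism of the standard resolution. -/
lemma exists_stdδ_comp_shift_map (z : Cocycle W Y 1)
    (k : ∀ i : Paths V, Cochain ((evC i).obj W) ((evC i).obj Y) 0)
    (hk : ∀ i, evCochain i z.1 = δ 0 1 (k i))
    (h : ∀ a : Quiver.Total V, (evC a.src).obj W ⟶ (evC a.tgt).obj Y)
    (hh : ∀ a, arrowCommutator k a = Cochain.ofHom (h a)) :
    stdδ W ≫ (Q.map (freeDesc h : arrowC W ⟶ Y))⟦(1 : ℤ)⟧' =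
      - Q.map (Cocycle.equivHomShift.symm z) ≫ (Q.commShiftIso (1 : ℤ)).hom.app Y := by
  obtain ⟨κ, hκ⟩ := exists_freeCochain (τ := fun i : Paths V => i)
    (M := fun i => (evC i).obj W) (Y := Y) k
  have h1 : (fun i => freeCochainRestrict κ i) = k := funext hκ
  have h2 : (Cochain.ofHom (stdD W)).comp κ (zero_add 0) = Cochain.ofHom (freeDesc h) := by
    refine freeCochain_ext (fun a => (freeCochainRestrict_stdD_comp κ a).trans ?_)
    refine (congrArg (fun κ => arrowCommutator (X := W) (Y := Y) κ a) h1).trans ((hh a).trans ?_)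
    have h3 : freeUnit (fun a : Quiver.Total V => a.tgt) (fun a => (evC a.src).obj W) a ≫
      (evC a.tgt).map (freeDesc h) = h a := freeUnit_freeDesc h a
    rw [freeCochainRestrict, evCochain_ofHom, ← Cochain.ofHom_comp, h3]
  have h3 : δ 0 1 κ = (Cochain.ofHom (stdπ W)).comp z.1 (zero_add 1) := by
    refine freeCochain_ext (fun i => ?_)
    rw [← δ_freeCochainRestrict, hκ]
    exact (hk i).symm.trans (freeCochainRestrict_stdπ_comp z.1 i).symm
  exact triangleOfSESδ_comp_shift_map (stdShortComplex_shortExact W) _ κ z h2 h3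

/-- A morphism in the derived category of representations which vanishes at all vertices is the
class of a cocycle that is determined by a family of morphisms indexed by the arrows. -/
lemma exists_arrows_of_evQ_eq_zero (φ : Q.obj W ⟶ Q.obj (Y⟦(1 : ℤ)⟧)) (hφ : ∀ i, evQ i φ = 0) :
    ∃ ψ : ∀ a : Quiver.Total V, Q.obj ((evC a.src).obj W) ⟶ Q.obj ((evC a.tgt).obj Y),
      ∀ (h : ∀ a : Quiver.Total V, (evC a.src).obj W ⟶ (evC a.tgt).obj Y)
        (_ : ∀ a, Q.map (h a) = ψ a) (z : Cocycle W Y 1)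
        (k : ∀ i : Paths V, Cochain ((evC i).obj W) ((evC i).obj Y) 0)
        (_ : ∀ i, evCochain i z.1 = δ 0 1 (k i))
        (_ : ∀ a, arrowCommutator k a = Cochain.ofHom (h a)),
        φ = - Q.map (Cocycle.equivHomShift.symm z) := by
  have h0 : Q.map (stdπ W) ≫ φ = 0 := by
    refine Q_freeC_hom_ext (fun i => (vertexUnit_comp_evQ_stdπ φ i).trans ?_)
    rw [hφ, evQ_zero, comp_zero]
  obtain ⟨g, hg⟩ : ∃ g, φ ≫ (Q.commShiftIso (1 : ℤ)).hom.app Y = stdδ W ≫ g :=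
    Triangle.yoneda_exact₃ _ (triangleOfSES_distinguished (stdShortComplex_shortExact W)) _
      ((Category.assoc _ _ _).symm.trans
        ((congrArg (· ≫ (Q.commShiftIso (1 : ℤ)).hom.app Y) h0).trans zero_comp))
  obtain ⟨g, rfl⟩ := (shiftFunctor (DerivedCategory (Paths V ⥤ E)) (1 : ℤ)).map_surjective g
  refine ⟨fun a => Q.map (arrowUnit W a) ≫ evQ a.tgt g, fun h h1 z k hk hh => ?_⟩
  have h2 : g = Q.map (freeDesc h : arrowC W ⟶ Y) := by
    refine Q_freeC_hom_ext (fun a => (h1 a).symm.trans ?_)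
    rw [evQ_Q_map, ← Q.map_comp, freeUnit_freeDesc]
  have h3 := exists_stdδ_comp_shift_map z k hk h hh
  rw [← h2] at h3
  rw [← cancel_mono ((Q.commShiftIso (1 : ℤ)).hom.app Y)]
  exact hg.trans (h3.trans (Preadditive.neg_comp _ _).symm)

/-- If the cocycle attached to a family of morphisms indexed by the arrows vanishes in the derived
category, then this family consists of commutators in the derived category of `E`. -/
lemma exists_commutator_of_Q_map_eq_zero (z : Cocycle W Y 1)
    (k : ∀ i : Paths V, Cochain ((evC i).obj W) ((evC i).obj Y) 0)
    (hk : ∀ i, evCochain i z.1 = δ 0 1 (k i))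
    (h : ∀ a : Quiver.Total V, (evC a.src).obj W ⟶ (evC a.tgt).obj Y)
    (hh : ∀ a, arrowCommutator k a = Cochain.ofHom (h a))
    (hz : Q.map (Cocycle.equivHomShift.symm z) = 0) :
    ∃ l : ∀ i : Paths V, Q.obj ((evC i).obj W) ⟶ Q.obj ((evC i).obj Y),
      ∀ a : Quiver.Total V, Q.map (h a) =
        l a.src ≫ Q.map (evCMap Y a.arrow) - Q.map (evCMap W a.arrow) ≫ l a.tgt := by
  have h1 := exists_stdδ_comp_shift_map z k hk h hh
  rw [hz, zero_comp, neg_zero] at h1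
  obtain ⟨g, hg⟩ : ∃ g, (Q.map (freeDesc h : arrowC W ⟶ Y))⟦(1 : ℤ)⟧' =
      (-(Q.map (stdD W))⟦(1 : ℤ)⟧') ≫ g :=
    Triangle.yoneda_exact₃ _ (rot_of_distTriang _
      (triangleOfSES_distinguished (stdShortComplex_shortExact W))) _ h1
  obtain ⟨g, rfl⟩ := (shiftFunctor (DerivedCategory (Paths V ⥤ E)) (1 : ℤ)).map_surjective g
  have h2 : Q.map (freeDesc h : arrowC W ⟶ Y) = Q.map (stdD W) ≫ (-g) := by
    refine (shiftFunctor _ (1 : ℤ)).map_injective (hg.trans ?_)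
    rw [Preadditive.comp_neg, Functor.map_neg, Functor.map_comp]
    exact Preadditive.neg_comp _ _
  refine ⟨fun i => Q.map (vertexUnit W i) ≫ evQ i (-g), fun a => ?_⟩
  refine Eq.trans ?_ (arrowUnit_comp_evQ_stdD (-g) a)
  rw [← h2, evQ_Q_map, ← Q.map_comp]
  exact congrArg Q.map (freeUnit_freeDesc h a).symm

end StandardTriangle

/-! ### Fully faithfulness for representations -/

section FunctorsOnDiagrams

open CochainComplex.HomComplex DerivedCategory

variable {A : Type*} [Category* A] {B : Type*} [Category* B]

/-- The functor on complexes induced by an additive functor. -/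
abbrev mapC [Preadditive A] [Preadditive B] (F : A ⥤ B) [F.Additive] :
    CochainComplex A ℤ ⥤ CochainComplex B ℤ :=
  F.mapHomologicalComplex (.up ℤ)

/-- The image of a cocycle by an additive functor. -/
def mapCocycle [Preadditive A] [Preadditive B] (F : A ⥤ B) [F.Additive]
    {X Y : CochainComplex A ℤ} {n : ℤ} (z : Cocycle X Y n) :
    Cocycle ((mapC F).obj X) ((mapC F).obj Y) n :=
  Cocycle.mk (z.1.map F) (n + 1) rfl (by rw [δ_map]; simp)

end FunctorsOnDiagrams

section FullyFaithful

open CochainComplex.HomComplex DerivedCategory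

variable {A : Type*} [Category* A] [Abelian A] {B : Type*} [Category* B] [Abelian B]
  [HasDerivedCategory B]

/-- The functor `F` induces bijections from the homotopy classes of morphisms between the complexes
satisfying `P` to the morphisms between their images in the derived category. When these are
bounded below complexes of injective objects, this means that the right derived functor of `F` is
fully faithful on these complexes. -/
structure DerivedFullyFaithful (F : A ⥤ B) [F.Additive]
    (P : ObjectProperty (CochainComplex A ℤ)) : Prop where
  full : ∀ {X Y : CochainComplex A ℤ}, P X → P Y →
    ∀ φ : Q.obj ((mapC F).obj X) ⟶ Q.obj ((mapC F).obj Y), ∃ f : X ⟶ Y, Q.map ((mapC F).map f) = φ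
  faithful : ∀ {X Y : CochainComplex A ℤ}, P X → P Y → ∀ f : X ⟶ Y,
    Q.map ((mapC F).map f) = 0 → Nonempty (Homotopy f 0)

lemma DerivedFullyFaithful.homotopy {F : A ⥤ B} [F.Additive]
    {P : ObjectProperty (CochainComplex A ℤ)} (hF : DerivedFullyFaithful F P)
    {X Y : CochainComplex A ℤ} (hX : P X) (hY : P Y) {f g : X ⟶ Y}
    (h : Q.map ((mapC F).map f) = Q.map ((mapC F).map g)) : Nonempty (Homotopy f g) := by
  obtain ⟨h⟩ := hF.faithful hX hY (f - g) (by rw [Functor.map_sub, Functor.map_sub, h, sub_self])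
  exact ⟨(Homotopy.equivSubZero (f := f) (g := g)).symm h⟩

/-- The complexes of injective objects of `J ⥤ A` with values in `P`. -/
def injectiveDiagramsInto (J : Type*) [Category* J] (P : ObjectProperty (CochainComplex A ℤ)) :
    ObjectProperty (CochainComplex (J ⥤ A) ℤ) :=
  fun X => (∀ n, Injective (X.X n)) ∧ ∀ i, P ((evC i).obj X)

lemma arrowCommutator_map {V : Type*} [Quiver V] (F : A ⥤ B) [F.Additive]
    {X Y : CochainComplex (Paths V ⥤ A) ℤ} {n : ℤ}
    (k : ∀ i : Paths V, Cochain ((evC i).obj X) ((evC i).obj Y) n) (a : Quiver.Total V) :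
    arrowCommutator (X := (mapC (functorOnDiagrams (Paths V) F)).obj X)
      (Y := (mapC (functorOnDiagrams (Paths V) F)).obj Y) (fun i => (k i).map F) a =
      (arrowCommutator k a).map F := by
  have h : (arrowCommutator k a).map F =
      ((k a.src).map F).comp (Cochain.ofHom ((mapC F).map (evCMap Y a.arrow))) (add_zero n) -
      (Cochain.ofHom ((mapC F).map (evCMap X a.arrow))).comp ((k a.tgt).map F) (zero_add n) := by
    rw [arrowCommutator, Cochain.map_sub, Cochain.map_comp, Cochain.map_comp,
      Cochain.map_ofHom, Cochain.map_ofHom]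
  exact h.symm

variable {V : Type*} [Quiver V] [Finite V] [∀ i j : V, Finite (i ⟶ j)]
  [∀ i j : Paths V, HasCoproductsOfShape (i ⟶ j) B]
  [∀ i j : Paths V, HasExactColimitsOfShape (Discrete (i ⟶ j)) B]
  [HasDerivedCategory (Paths V ⥤ B)]
  (F : A ⥤ B) [F.Additive] {P : ObjectProperty (CochainComplex A ℤ)}

/-- The fully faithfulness is inherited by the functor between the categories of representations of
a finite quiver. -/
lemma DerivedFullyFaithful.functorOnDiagrams [P.IsClosedUnderIsomorphisms]
    (hP : ∀ X, P X → P (X⟦(-1 : ℤ)⟧)) (hF : DerivedFullyFaithful F P) :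
    DerivedFullyFaithful (functorOnDiagrams (Paths V) F) (injectiveDiagramsInto (Paths V) P) := by
  have hshift : ∀ {Y : CochainComplex (Paths V ⥤ A) ℤ} (hY : injectiveDiagramsInto (Paths V) P Y),
      ∃ (Y' : CochainComplex (Paths V ⥤ A) ℤ) (_ : ∀ n, Injective (Y'.X n))
        (_ : ∀ i, P ((evC i).obj Y')), Nonempty (Y ≅ Y'⟦(1 : ℤ)⟧) := by
    intro Y hY
    refine ⟨Y⟦(-1 : ℤ)⟧, fun n => hY.1 (n + (-1)), fun i => ?_,
      ⟨((shiftEquiv (CochainComplex (Paths V ⥤ A) ℤ) (1 : ℤ)).counitIso.app Y).symm⟩⟩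
    exact P.prop_of_iso ((((evaluation (Paths V) A).obj i).mapHomologicalComplex
      (.up ℤ)).commShiftIso (-1 : ℤ) |>.app Y).symm (hP _ (hY.2 i))
  let G := mapC (_root_.functorOnDiagrams (Paths V) F)
  constructor
  · intro X Y hX hY φ
    have := hY.1
    choose f hf using fun i => hF.full (hX.2 i) (hY.2 i) (evQ i φ)
    obtain ⟨g, hg⟩ := exists_hom_of_homotopy_commutative f (fun a =>
      hF.homotopy (hX.2 _) (hY.2 _) (by
        rw [(mapC F).map_comp, (mapC F).map_comp, Q.map_comp, Q.map_comp, hf, hf]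
        exact evQ_naturality φ a.arrow))
    -- it remains to treat the difference, which vanishes at all vertices
    have hφ : ∀ i, evQ i (φ - Q.map (G.map g)) = 0 := fun i => by
      have h1 : evQ i (Q.map (G.map g)) = evQ i φ := by
        refine (evQ_Q_map i (G.map g)).trans (Eq.trans ?_ (hf i))
        exact Q_map_eq_of_homotopy _ ((F.mapHomotopy (hg i).some))
      rw [evQ_sub, h1, sub_self]
    obtain ⟨Y', hY', hPY', ⟨e⟩⟩ := hshift hY
    let α : G.obj Y ≅ (G.obj Y')⟦(1 : ℤ)⟧ :=
      G.mapIso e ≪≫ (G.commShiftIso (1 : ℤ)).app Y'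
    obtain ⟨ψ, hψ⟩ := exists_arrows_of_evQ_eq_zero ((φ - Q.map (G.map g)) ≫ Q.map α.hom)
      (fun i => by rw [evQ_comp, hφ, zero_comp])
    choose h hh using fun a => hF.full (hX.2 _) (hPY' _) (ψ a)
    obtain ⟨k, z, hk, hz⟩ := exists_cocycle_of_arrows h
    have h1 := hψ (fun a => (mapC F).map (h a)) hh (mapCocycle _ z) (fun i => (k i).map F)
      (fun i => (congrArg (fun c => Cochain.map c F) (hz i)).trans (δ_map _ _ _ _).symm)
      (fun a => by
        refine (arrowCommutator_map F k a).trans ?_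
        rw [hk]
        exact Cochain.map_ofHom _ _ _ _)
    refine ⟨g - Cocycle.equivHomShift.symm z ≫ e.inv, ?_⟩
    have h2 : G.map (Cocycle.equivHomShift.symm z) ≫ (G.commShiftIso (1 : ℤ)).hom.app Y' =
      Cocycle.equivHomShift.symm (mapCocycle _ z) := map_equivHomShift_symm _ z
    rw [← h2] at h1
    have h3 : G.map (Cocycle.equivHomShift.symm z) ≫ (G.commShiftIso (1 : ℤ)).hom.app Y' =
        G.map (Cocycle.equivHomShift.symm z ≫ e.inv) ≫ α.hom := by
      simp [α, ← Functor.map_comp_assoc]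
    rw [h3, Q.map_comp, ← Preadditive.neg_comp, cancel_mono] at h1
    rw [Functor.map_sub, Functor.map_sub, sub_eq_add_neg, ← h1]
    exact add_sub_cancel _ _
  · intro X Y hX hY f hf
    obtain ⟨Y', hY', hPY', ⟨e⟩⟩ := hshift hY
    let z := Cocycle.equivHomShift (f ≫ e.hom)
    have hz : Cocycle.equivHomShift.symm z = f ≫ e.hom := by simp [z]
    have hf' : ∀ i, Nonempty (Homotopy ((evC i).map f) 0) := fun i =>
      hF.faithful (hX.2 i) (hY.2 i) _ (by
        refine Eq.trans (evQ_Q_map i (G.map f)).symm ?_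
        rw [hf, evQ_zero]
        rfl)
    have hk : ∀ i, ∃ k : Cochain ((evC i).obj X) ((evC i).obj Y') 0,
        δ 0 1 k = evCochain i z.1 := fun i => by
      refine (quotient_map_equivHomShift_symm_eq_zero_iff (zero_add 1)
        (mapCocycle ((evaluation _ A).obj i) z)).1 ?_
      have h1 := map_equivHomShift_symm ((evaluation _ A).obj i) z
      refine (congrArg (HomotopyCategory.quotient A (.up ℤ)).map h1).symm.trans ?_
      rw [hz, Functor.map_comp, Functor.map_comp, Functor.map_comp,
        HomotopyCategory.eq_of_homotopy _ _ (hf' i).some]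
      simp
    choose k hk using hk
    obtain ⟨h, hh⟩ := exists_arrows_of_cocycle z k (fun i => (hk i).symm)
    obtain ⟨l, hl⟩ := exists_commutator_of_Q_map_eq_zero
      (mapCocycle (_root_.functorOnDiagrams (Paths V) F) z) (fun i => (k i).map F)
      (fun i => (congrArg (fun c => Cochain.map c F) (hk i).symm).trans (δ_map _ _ _ _).symm)
      (fun a => (mapC F).map (h a))
      (fun a => by
        refine (arrowCommutator_map F k a).trans ?_
        rw [hh]
        exact Cochain.map_ofHom _ _ _ _)
      (by
        have h1 := map_equivHomShift_symm (_root_.functorOnDiagrams (Paths V) F) z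
        refine (congrArg Q.map h1).symm.trans ?_
        rw [hz, (mapC (_root_.functorOnDiagrams (Paths V) F)).map_comp, Q.map_comp, Q.map_comp, hf,
          zero_comp, zero_comp])
    choose m hm using fun i => hF.full (hX.2 i) (hPY' i) (l i)
    obtain ⟨y, hy⟩ := exists_cobounding_of_arrows z k (fun i => (hk i).symm) h hh m (fun a =>
      hF.homotopy (hX.2 _) (hPY' _) (by
        rw [(mapC F).map_sub, Q.map_sub, (mapC F).map_comp, (mapC F).map_comp, Q.map_comp,
          Q.map_comp, hm, hm]
        exact hl a))
    have h0 := (quotient_map_equivHomShift_symm_eq_zero_iff (zero_add 1) z).2 ⟨y, hy⟩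
    rw [hz, Functor.map_comp] at h0
    rw [← HomotopyCategory.quotient_map_eq_zero_iff]
    rwa [← cancel_mono ((HomotopyCategory.quotient _ (.up ℤ)).map e.hom), zero_comp]

end FullyFaithful

/-! ### Right derived functors on complexes of injective objects -/

section Restriction

variable {C D : Type*} [Category* C] [Category* D] (R : C ⥤ D)
    (P : ObjectProperty C) (P' : ObjectProperty D)

/-- An equivalence between full subcategories, without reference to the induced functor. -/
lemma restrictsToEquivalence_iff :
    RestrictsToEquivalence R P P' ↔ (∀ X, P X → P' (R.obj X)) ∧
      (∀ X Y, P X → P Y → Function.Bijective (R.map : (X ⟶ Y) → _)) ∧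
        ∀ Z, P' Z → ∃ X, P X ∧ Nonempty (R.obj X ≅ Z) := by
  constructor
  · rintro ⟨h, hE⟩
    let G := P'.lift (P.ι ⋙ R) (fun X => h X.obj X.property)
    have : G.IsEquivalence := hE
    refine ⟨h, fun X Y hX hY => ⟨fun f g hfg => ?_, fun g => ?_⟩, fun Z hZ => ?_⟩
    · let f' : (⟨X, hX⟩ : P.FullSubcategory) ⟶ ⟨Y, hY⟩ := ObjectProperty.homMk f
      let g' : (⟨X, hX⟩ : P.FullSubcategory) ⟶ ⟨Y, hY⟩ := ObjectProperty.homMk g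
      have h1 : f' = g' := G.map_injective (by ext; exact hfg)
      exact congrArg (fun k => k.hom) h1
    · let g' : G.obj ⟨X, hX⟩ ⟶ G.obj ⟨Y, hY⟩ := ObjectProperty.homMk g
      obtain ⟨f, hf⟩ := G.map_surjective g'
      exact ⟨f.hom, congrArg (fun k => k.hom) hf⟩
    · exact ⟨(G.objPreimage ⟨Z, hZ⟩).obj, (G.objPreimage ⟨Z, hZ⟩).property,
        ⟨P'.ι.mapIso (G.objObjPreimageIso ⟨Z, hZ⟩)⟩⟩
  · rintro ⟨h1, h2, h3⟩
    refine ⟨h1, { faithful := ⟨fun {X Y f g} hfg => ?_⟩, full := ⟨fun {X Y} g => ?_⟩,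
                  essSurj := ⟨fun Z => ?_⟩ }⟩
    · ext
      exact (h2 _ _ X.property Y.property).1 (congrArg (fun k => k.hom) hfg)
    · obtain ⟨f, hf⟩ := (h2 _ _ X.property Y.property).2 g.hom
      exact ⟨ObjectProperty.homMk f, by ext; exact hf⟩
    · obtain ⟨X, hX, ⟨e⟩⟩ := h3 Z.obj Z.property
      exact ⟨⟨X, hX⟩, ⟨P'.ι.preimageIso e⟩⟩

lemma bijective_map_of_iso {X Y X' Y' : C} (e : X ≅ X') (e' : Y ≅ Y')
    (h : Function.Bijective (R.map : (X ⟶ Y) → _)) :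
    Function.Bijective (R.map : (X' ⟶ Y') → _) := by
  constructor
  · intro f g hfg
    have : e.hom ≫ f ≫ e'.inv = e.hom ≫ g ≫ e'.inv := h.1 (by simp [hfg])
    simpa using this
  · intro g
    obtain ⟨f, hf⟩ := h.2 (R.map e.hom ≫ g ≫ R.map e'.inv)
    refine ⟨e.inv ≫ f ≫ e'.hom, ?_⟩
    simp [hf, ← R.map_comp_assoc, ← R.map_comp]

end Restriction

section DerivedFunctor

open DerivedCategory

variable {A : Type*} [Category* A] [Abelian A] [HasDerivedCategory A]
  {B : Type*} [Category* B] [Abelian B] [HasDerivedCategory B]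
  (F : A ⥤ B) [F.Additive] (R : ObjectProperty (DerivedCategory A))
  (R' : ObjectProperty (DerivedCategory B))

/-- The bounded below complexes of injective objects the classes of which in the derived category
satisfy `R`. -/
def injectiveModels : ObjectProperty (CochainComplex A ℤ) := fun X =>
  (∀ n, Injective (X.X n)) ∧ CochainComplex.plus A X ∧ R (Q.obj X)

variable [EnoughInjectives A]

lemma isIso_rightDerivedFunctorPlusUnit_app (K : HomotopyCategory.Plus A)
    [∀ n, Injective (K.obj.as.X n)] : IsIso (F.rightDerivedFunctorPlusUnit.app K) :=
  inferInstance

/-- The value of the right derived functor on a bounded below complex of injective objects. -/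
noncomputable def rightDerivedIso (K : CochainComplex.Plus A) (hK : ∀ n, Injective (K.obj.X n)) :
    Plus.Q.obj (F.mapCochainComplexPlus.obj K) ≅ F.rightDerivedFunctorPlus.obj (Plus.Q.obj K) :=
  have : ∀ n, Injective (((HomotopyCategory.Plus.quotient A).obj K).obj.as.X n) := hK
  have := isIso_rightDerivedFunctorPlusUnit_app F ((HomotopyCategory.Plus.quotient A).obj K)
  @asIso _ _ _ _ (F.rightDerivedFunctorPlusUnit.app ((HomotopyCategory.Plus.quotient A).obj K)) this

lemma rightDerivedIso_naturality {K L : CochainComplex.Plus A} (hK : ∀ n, Injective (K.obj.X n))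
    (hL : ∀ n, Injective (L.obj.X n)) (f : K ⟶ L) :
    Plus.Q.map (F.mapCochainComplexPlus.map f) ≫ (rightDerivedIso F L hL).hom =
      (rightDerivedIso F K hK).hom ≫ F.rightDerivedFunctorPlus.map (Plus.Q.map f) :=
  F.rightDerivedFunctorPlusUnit.naturality ((HomotopyCategory.Plus.quotient A).map f)

/-- Bounded below complexes of injective objects are K-injective. -/
lemma Plus_Q_map_surjective {K L : CochainComplex.Plus A} (hL : ∀ n, Injective (L.obj.X n)) :
    Function.Surjective (Plus.Q.map : (K ⟶ L) → _) := by
  intro g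
  have : L.obj.IsKInjective := by
    obtain ⟨n, _⟩ := L.property
    exact CochainComplex.isKInjective_of_injective L.obj n
  obtain ⟨g, rfl⟩ := (Plus.Qh_map_bijective_of_isKInjective
    ((HomotopyCategory.Plus.quotient A).obj K) ((HomotopyCategory.Plus.quotient A).obj L) this).2 g
  obtain ⟨g, rfl⟩ := (HomotopyCategory.Plus.quotient A).map_surjective g
  exact ⟨g, rfl⟩

lemma homotopy_of_Plus_Q_map_eq_zero {K L : CochainComplex.Plus A}
    (hL : ∀ n, Injective (L.obj.X n)) (f : K ⟶ L) (hf : Q.map f.hom = 0) :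
    Nonempty (Homotopy f.hom 0) := by
  have : L.obj.IsKInjective := by
    obtain ⟨n, _⟩ := L.property
    exact CochainComplex.isKInjective_of_injective L.obj n
  rw [← HomotopyCategory.quotient_map_eq_zero_iff]
  refine (CochainComplex.IsKInjective.Qh_map_bijective _ L.obj).1 ?_
  refine Eq.trans ?_ (Functor.map_zero Qh _ _).symm
  exact hf

lemma exists_injective_model (X : Plus A) :
    ∃ (K : CochainComplex.Plus A) (_ : ∀ n, Injective (K.obj.X n)),
      Nonempty (Plus.Q.obj K ≅ X) := by
  obtain ⟨n, hn⟩ := X.property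
  have : X.IsGE n := (Plus.isGE_ι_obj_iff X n).1 hn
  obtain ⟨L, _, h⟩ := Plus.exists_injective_nonempty_iso X n
  exact ⟨(InjectiveObject.ι A).mapCochainComplexPlus.obj L, fun n =>
    inferInstanceAs (Injective ((InjectiveObject.ι A).obj (L.obj.X n))), h⟩

variable [R.IsClosedUnderIsomorphisms] [R'.IsClosedUnderIsomorphisms]

/-- The description of the equivalences induced by the right derived functor in terms of bounded
below complexes of injective objects. -/
lemma restrictsToEquivalence_rightDerivedFunctorPlus_iff :
    RestrictsToEquivalence F.rightDerivedFunctorPlus (R.inverseImage Plus.ι)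
        (R'.inverseImage Plus.ι) ↔
      (∀ X, injectiveModels R X → R' (Q.obj ((mapC F).obj X))) ∧
      DerivedFullyFaithful F (injectiveModels R) ∧
      ∀ Z : CochainComplex B ℤ, CochainComplex.plus B Z → R' (Q.obj Z) →
        ∃ X, injectiveModels R X ∧ Nonempty (Q.obj ((mapC F).obj X) ≅ Q.obj Z) := by
  rw [restrictsToEquivalence_iff]
  constructor
  · rintro ⟨h1, h2, h3⟩
    refine ⟨fun X hX => ?_, ⟨fun {X Y} hX hY φ => ?_, fun {X Y} hX hY f hf => ?_⟩,
      fun Z hZ hZ' => ?_⟩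
    · exact R'.prop_of_iso (Plus.ι.mapIso (rightDerivedIso F ⟨X, hX.2.1⟩ hX.1)).symm
        (h1 (Plus.Q.obj ⟨X, hX.2.1⟩) hX.2.2)
    · let K : CochainComplex.Plus A := ⟨X, hX.2.1⟩
      let L : CochainComplex.Plus A := ⟨Y, hY.2.1⟩
      let φ' : Plus.Q.obj (F.mapCochainComplexPlus.obj K) ⟶
        Plus.Q.obj (F.mapCochainComplexPlus.obj L) := Plus.ι.preimage φ
      have hφ' : Plus.ι.map φ' = φ := Functor.map_preimage (Plus.ι (C := B))
        (X := Plus.Q.obj (F.mapCochainComplexPlus.obj K))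
        (Y := Plus.Q.obj (F.mapCochainComplexPlus.obj L)) φ
      obtain ⟨g, hg⟩ := (h2 (Plus.Q.obj K) (Plus.Q.obj L) hX.2.2 hY.2.2).2
        ((rightDerivedIso F K hX.1).inv ≫ φ' ≫ (rightDerivedIso F L hY.1).hom)
      obtain ⟨f, rfl⟩ := Plus_Q_map_surjective hY.1 g
      refine ⟨f.hom, ?_⟩
      have h4 := rightDerivedIso_naturality F hX.1 hY.1 f
      rw [hg, Iso.hom_inv_id_assoc, cancel_mono] at h4
      rw [← hφ', ← h4]
      rfl
    · let f' : (⟨X, hX.2.1⟩ : CochainComplex.Plus A) ⟶ ⟨Y, hY.2.1⟩ := ObjectProperty.homMk f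
      have h4 : Plus.Q.map (F.mapCochainComplexPlus.map f') =
          Plus.Q.map (F.mapCochainComplexPlus.map 0) := Plus.ι.map_injective
        (hf.trans ((congrArg Q.map (Functor.map_zero (mapC F) X Y)).trans (Q.map_zero _ _)).symm)
      have h5 := rightDerivedIso_naturality F hX.1 hY.1 f'
      rw [h4, rightDerivedIso_naturality F hX.1 hY.1 0, cancel_epi] at h5
      have h6 : Plus.Q.map f' = Plus.Q.map 0 :=
        (h2 (Plus.Q.obj ⟨X, hX.2.1⟩) (Plus.Q.obj ⟨Y, hY.2.1⟩) hX.2.2 hY.2.2).1 h5.symm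
      refine homotopy_of_Plus_Q_map_eq_zero hY.1 f' ?_
      exact (congrArg Plus.ι.map h6).trans (Functor.map_zero Q _ _)
    · obtain ⟨T, hT, ⟨e⟩⟩ := h3 (Plus.Q.obj ⟨Z, hZ⟩) hZ'
      obtain ⟨K, hK, ⟨e'⟩⟩ := exists_injective_model T
      exact ⟨K.obj, ⟨hK, K.property, R.prop_of_iso (Plus.ι.mapIso e').symm hT⟩,
        ⟨Plus.ι.mapIso (rightDerivedIso F K hK ≪≫ F.rightDerivedFunctorPlus.mapIso e' ≪≫ e)⟩⟩
  · rintro ⟨h1, h2, h3⟩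
    refine ⟨fun T hT => ?_, fun T U hT hU => ?_, fun Z hZ => ?_⟩
    · obtain ⟨K, hK, ⟨e⟩⟩ := exists_injective_model T
      exact R'.prop_of_iso (Plus.ι.mapIso (rightDerivedIso F K hK ≪≫
        F.rightDerivedFunctorPlus.mapIso e))
        (h1 K.obj ⟨hK, K.property, R.prop_of_iso (Plus.ι.mapIso e).symm hT⟩)
    · obtain ⟨K, hK, ⟨e⟩⟩ := exists_injective_model T
      obtain ⟨L, hL, ⟨e'⟩⟩ := exists_injective_model U
      refine bijective_map_of_iso _ e e' ?_
      have hK' : injectiveModels R K.obj :=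
        ⟨hK, K.property, R.prop_of_iso (Plus.ι.mapIso e).symm hT⟩
      have hL' : injectiveModels R L.obj :=
        ⟨hL, L.property, R.prop_of_iso (Plus.ι.mapIso e').symm hU⟩
      constructor
      · intro f g hfg
        obtain ⟨f, rfl⟩ := Plus_Q_map_surjective hL f
        obtain ⟨g, rfl⟩ := Plus_Q_map_surjective hL g
        have h4 := (rightDerivedIso_naturality F hK hL f).trans
          ((_ ≫= hfg).trans (rightDerivedIso_naturality F hK hL g).symm)
        rw [cancel_mono] at h4
        obtain ⟨h5⟩ := h2.homotopy hK' hL' (congrArg Plus.ι.map h4)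
        exact Plus.ι.map_injective (Q_map_eq_of_homotopy _ h5)
      · intro g
        obtain ⟨f, hf⟩ := h2.full hK' hL' (Plus.ι.map
          ((rightDerivedIso F K hK).hom ≫ g ≫ (rightDerivedIso F L hL).inv))
        let f' : K ⟶ L := ObjectProperty.homMk f
        refine ⟨Plus.Q.map f', ?_⟩
        have h4 := rightDerivedIso_naturality F hK hL f'
        have h5 : Plus.Q.map (F.mapCochainComplexPlus.map f') =
          (rightDerivedIso F K hK).hom ≫ g ≫ (rightDerivedIso F L hL).inv :=
          Plus.ι.map_injective hf
        rw [h5] at h4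
        rw [← cancel_epi (rightDerivedIso F K hK).hom, ← h4]
        simp
    · obtain ⟨n, Z', e, hn⟩ := Z.property
      obtain ⟨X, hX, ⟨e'⟩⟩ := h3 Z' ⟨n, hn⟩ (R'.prop_of_iso e hZ)
      refine ⟨Plus.Q.obj ⟨X, hX.2.1⟩, hX.2.2, ⟨(rightDerivedIso F ⟨X, hX.2.1⟩ hX.1).symm ≪≫
        Plus.ι.preimageIso (e' ≪≫ e.symm)⟩⟩

end DerivedFunctor

/-! ### Cohomology conditions and vertices -/

section Cohomology

open DerivedCategory

variable {E : Type*} [Category* E] [Abelian E] [HasDerivedCategory E]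

/-- The objects of the derived category all of whose cohomology objects belong to `P`. -/
def cohomologyIn (P : ObjectProperty E) : ObjectProperty (DerivedCategory E) :=
  fun X => ∀ n : ℤ, P ((homologyFunctor E n).obj X)

instance (P : ObjectProperty E) [P.IsClosedUnderIsomorphisms] :
    (cohomologyIn P).IsClosedUnderIsomorphisms where
  of_iso e h n := P.prop_of_iso ((homologyFunctor E n).mapIso e) (h n)

lemma cohomologyIn_shift (P : ObjectProperty E) [P.IsClosedUnderIsomorphisms]
    {X : DerivedCategory E} (h : cohomologyIn P X) (m : ℤ) : cohomologyIn P (X⟦m⟧) := fun n =>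
  P.prop_of_iso (((homologyFunctor E 0).shiftIso m n (m + n) rfl).app X).symm (h (m + n))

lemma bounded_shift {X : DerivedCategory E} (h : TStructure.t.bounded X) (m : ℤ) :
    TStructure.t.bounded (X⟦m⟧) :=
  ObjectProperty.le_shift TStructure.t.bounded m X h

lemma bounded_iff (X : DerivedCategory E) :
    TStructure.t.bounded X ↔ (∃ a, ∀ n < a, IsZero ((homologyFunctor E n).obj X)) ∧
      ∃ b, ∀ n > b, IsZero ((homologyFunctor E n).obj X) := by
  refine and_congr (exists_congr fun a => ?_) (exists_congr fun b => ?_)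
  · exact isGE_iff X a
  · exact isLE_iff X b

end Cohomology

section Vertexwise

open DerivedCategory

variable {J : Type*} [Category* J] {E : Type*} [Category* E] [Abelian E] [HasDerivedCategory E]
  [HasDerivedCategory (J ⥤ E)]

/-- The cohomology of a complex of functors is computed objectwise. -/
noncomputable def homologyEvaluationIso (X : CochainComplex (J ⥤ E) ℤ) (n : ℤ) (j : J) :
    ((homologyFunctor (J ⥤ E) n).obj (Q.obj X)).obj j ≅
      (homologyFunctor E n).obj (Q.obj ((evC j).obj X)) :=
  ((evaluation J E).obj j).mapIso ((homologyFunctorFactors (J ⥤ E) n).app X) ≪≫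
    ((X.sc n).mapHomologyIso ((evaluation J E).obj j)).symm ≪≫
      ((homologyFunctorFactors E n).app ((evC j).obj X)).symm

lemma cohomologyIn_functorsInto_iff (P : ObjectProperty E) [P.IsClosedUnderIsomorphisms]
    (X : CochainComplex (J ⥤ E) ℤ) :
    cohomologyIn (functorsInto J P) (Q.obj X) ↔
      ∀ j, cohomologyIn P (Q.obj ((evC j).obj X)) := by
  constructor
  · intro h j n
    exact P.prop_of_iso (homologyEvaluationIso X n j) (h n j)
  · intro h n j
    exact P.prop_of_iso (homologyEvaluationIso X n j).symm (h j n)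

lemma exists_forall_lt_iff {J : Type*} [Finite J] (p : J → ℤ → Prop) :
    (∃ a, ∀ n < a, ∀ j, p j n) ↔ ∀ j, ∃ a, ∀ n < a, p j n := by
  constructor
  · rintro ⟨a, h⟩ j
    exact ⟨a, fun n hn => h n hn j⟩
  · intro h
    choose a ha using h
    obtain ⟨b, hb⟩ := (Set.finite_range a).bddBelow
    exact ⟨b, fun n hn j => ha j n (hn.trans_le (hb ⟨j, rfl⟩))⟩

lemma exists_forall_gt_iff {J : Type*} [Finite J] (p : J → ℤ → Prop) :
    (∃ a, ∀ n > a, ∀ j, p j n) ↔ ∀ j, ∃ a, ∀ n > a, p j n := by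
  constructor
  · rintro ⟨a, h⟩ j
    exact ⟨a, fun n hn => h n hn j⟩
  · intro h
    choose a ha using h
    obtain ⟨b, hb⟩ := (Set.finite_range a).bddAbove
    exact ⟨b, fun n hn j => ha j n ((hb ⟨j, rfl⟩).trans_lt hn)⟩

lemma bounded_Q_obj_iff [Finite J] (X : CochainComplex (J ⥤ E) ℤ) :
    TStructure.t.bounded (Q.obj X) ↔ ∀ j, TStructure.t.bounded (Q.obj ((evC j).obj X)) := by
  have h (n : ℤ) : IsZero ((homologyFunctor (J ⥤ E) n).obj (Q.obj X)) ↔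
      ∀ j, IsZero ((homologyFunctor E n).obj (Q.obj ((evC j).obj X))) :=
    (Functor.isZero_iff _).trans (forall_congr' fun j => (homologyEvaluationIso X n j).isZero_iff)
  simp only [bounded_iff, h, exists_forall_lt_iff,
    exists_forall_gt_iff, forall_and]

lemma plus_iff_evC [Finite J] (X : CochainComplex (J ⥤ E) ℤ) :
    CochainComplex.plus (J ⥤ E) X ↔ ∀ j, CochainComplex.plus E ((evC j).obj X) := by
  simp only [CochainComplex.plus_iff, CochainComplex.isStrictlyGE_iff]
  rw [← exists_forall_lt_iff
    (fun j n => IsZero (((evC j).obj X).X n))]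
  exact exists_congr fun a => forall_congr' fun n => forall_congr' fun _ => Functor.isZero_iff _

end Vertexwise

section ModelsOfDiagrams

open DerivedCategory

variable {A : Type*} [Category* A] [Abelian A] [HasDerivedCategory A]
  (R : ObjectProperty (DerivedCategory A)) [R.IsClosedUnderIsomorphisms]

instance : (injectiveModels R).IsClosedUnderIsomorphisms where
  of_iso {X Y} e h := by
    refine ⟨fun n => ?_, (CochainComplex.plus A).prop_of_iso e h.2.1,
      R.prop_of_iso (Q.mapIso e) h.2.2⟩
    have := h.1 n
    exact Injective.of_iso ((HomologicalComplex.eval A (.up ℤ) n).mapIso e) this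

lemma injectiveModels_shift {m : ℤ} (hR : ∀ X, R X → R (X⟦m⟧)) {X : CochainComplex A ℤ}
    (hX : injectiveModels R X) : injectiveModels R (X⟦m⟧) :=
  ⟨fun n => hX.1 (n + m), ObjectProperty.le_shift (CochainComplex.plus A) m X hX.2.1,
    R.prop_of_iso ((Q.commShiftIso m).app X).symm (hR _ hX.2.2)⟩

/-- A quasi-isomorphism between bounded below complexes of injectives is a homotopy equivalence, so
that its image by any additive functor is a quasi-isomorphism. -/
lemma isIso_Q_map_mapC_map {B : Type*} [Category* B] [Abelian B] [HasDerivedCategory B]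
    (F : A ⥤ B) [F.Additive] {K L : CochainComplex A ℤ} (hK : injectiveModels R K)
    (hL : injectiveModels R L) (f : K ⟶ L) [QuasiIso f] : IsIso (Q.map ((mapC F).map f)) := by
  have hK' : K.IsKInjective := by
    obtain ⟨n, _⟩ := hK.2.1
    have := hK.1
    exact CochainComplex.isKInjective_of_injective K n
  have hL' : L.IsKInjective := by
    obtain ⟨n, _⟩ := hL.2.1
    have := hL.1
    exact CochainComplex.isKInjective_of_injective L n
  obtain ⟨e, rfl⟩ := (CochainComplex.IsKInjective.quasiIso_iff f).1 inferInstance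
  rw [isIso_Q_map_iff_quasiIso]
  exact homotopyEquivalences_le_quasiIso _ _ _ ⟨F.mapHomotopyEquiv e, rfl⟩

end ModelsOfDiagrams

/-! ### Transfer of equivalences to representations -/

section Transfer

open DerivedCategory

variable {A : Type*} [Category* A] [Abelian A] [EnoughInjectives A] [HasDerivedCategory A]
  {B : Type*} [Category* B] [Abelian B] [HasDerivedCategory B]
  (F : A ⥤ B) [F.Additive]
  {V : Type*} [Quiver V] [Finite V] [∀ i j : V, Finite (i ⟶ j)]
  [∀ i j : Paths V, HasProductsOfShape (i ⟶ j) A]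
  [∀ i j : Paths V, HasCoproductsOfShape (i ⟶ j) B]
  [∀ i j : Paths V, HasExactColimitsOfShape (Discrete (i ⟶ j)) B]
  [HasDerivedCategory (Paths V ⥤ A)] [HasDerivedCategory (Paths V ⥤ B)]
  {R : ObjectProperty (DerivedCategory A)} {R' : ObjectProperty (DerivedCategory B)}
  {RQ : ObjectProperty (DerivedCategory (Paths V ⥤ A))}
  {RQ' : ObjectProperty (DerivedCategory (Paths V ⥤ B))}

lemma injectiveDiagramsInto_of_injectiveModels
    (hR : ∀ X, RQ (Q.obj X) ↔ ∀ i, R (Q.obj ((evC i).obj X)))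
    {X : CochainComplex (Paths V ⥤ A) ℤ} (hX : injectiveModels RQ X) :
    injectiveDiagramsInto (Paths V) (injectiveModels R) X :=
  ⟨hX.1, fun i => ⟨fun n => have := hX.1 n; injective_obj_of_injective (X.X n) i,
    (plus_iff_evC X).1 hX.2.1 i, (hR X).1 hX.2.2 i⟩⟩

/-- Every bounded below complex of representations is quasi-isomorphic to a complex of injective
representations. -/
lemma exists_injective_diagram_resolution (X : CochainComplex (Paths V ⥤ A) ℤ)
    (hX : CochainComplex.plus _ X) :
    ∃ (I : CochainComplex (Paths V ⥤ A) ℤ) (_ : ∀ n, Injective (I.X n))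
      (_ : CochainComplex.plus _ I) (f : X ⟶ I), QuasiIso f := by
  have : EnoughInjectives (Paths V ⥤ A) := enoughInjectives_functor (Paths V) A
  obtain ⟨n, hn⟩ := hX
  obtain ⟨L, _, f, hf⟩ := CochainComplex.Plus.exists_quasiIso_injective ⟨X, n, hn⟩ n
  exact ⟨_, fun n => (L.obj.X n).property,
    ((InjectiveObject.ι (Paths V ⥤ A)).mapCochainComplexPlus.obj L).property, f.hom, hf⟩

/-- If the complexes with a property `R'` are images of complexes of injective objects, this is
also true for representations: the images are lifted at all vertices, the action of the arrows is
lifted, and the resulting representation in complexes is replaced by an injective resolution. -/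
lemma exists_injectiveModel_diagram [R.IsClosedUnderIsomorphisms]
    (hR : ∀ X, RQ (Q.obj X) ↔ ∀ i, R (Q.obj ((evC i).obj X)))
    (hR' : ∀ X, RQ' (Q.obj X) ↔ ∀ i, R' (Q.obj ((evC i).obj X)))
    (hF : DerivedFullyFaithful F (injectiveModels R))
    (hess : ∀ Z : CochainComplex B ℤ, CochainComplex.plus B Z → R' (Q.obj Z) →
        ∃ X, injectiveModels R X ∧ Nonempty (Q.obj ((mapC F).obj X) ≅ Q.obj Z))
    (Z : CochainComplex (Paths V ⥤ B) ℤ) (hZ : CochainComplex.plus _ Z) (hZ' : RQ' (Q.obj Z)) :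
    ∃ X, injectiveModels RQ X ∧
      Nonempty (Q.obj ((mapC (functorOnDiagrams (Paths V) F)).obj X) ≅ Q.obj Z) := by
  choose X hX u using fun i : Paths V =>
    hess ((evC i).obj Z) ((plus_iff_evC Z).1 hZ i) ((hR' Z).1 hZ' i)
  replace u i := (u i).some
  choose f hf using fun a : Quiver.Total V =>
    hF.full (hX a.src) (hX a.tgt) ((u a.src).hom ≫ Q.map (evCMap Z a.arrow) ≫ (u a.tgt).inv)
  let G : Paths V ⥤ CochainComplex A ℤ := Paths.lift
    { obj := fun i => X i
      map := fun {s t} b => f ⟨s, t, b⟩ }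
  have hG (a : Quiver.Total V) : G.map a.arrow = f a := Paths.lift_toPath _ _
  let C := complexOfFunctor G
  let e (i : Paths V) : (evC i).obj C ≅ X i := evCObjComplexOfFunctor G i
  have he (a : Quiver.Total V) : evCMap C a.arrow ≫ (e a.tgt).hom = (e a.src).hom ≫ f a :=
    (evCMap_complexOfFunctor G a.arrow).trans (_ ≫= hG a)
  have hC (i : Paths V) : injectiveModels R ((evC i).obj C) :=
    (injectiveModels R).prop_of_iso (e i).symm (hX i)
  obtain ⟨I, hI, hI', r, hr⟩ := exists_injective_diagram_resolution C
    ((plus_iff_evC C).2 fun i => (hC i).2.1)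
  have hr' (i : Paths V) : QuasiIso ((evC i).map r) :=
    (HomologicalComplex.quasiIso_iff_evaluation r).1 hr i
  have hIR (i : Paths V) : R (Q.obj ((evC i).obj I)) :=
    R.prop_of_iso (asIso (Q.map ((evC i).map r))) (hC i).2.2
  have hIQ : injectiveModels RQ I := ⟨hI, hI', (hR I).2 hIR⟩
  have hI2 (i : Paths V) : injectiveModels R ((evC i).obj I) :=
    (injectiveDiagramsInto_of_injectiveModels hR hIQ).2 i
  have hiso (i : Paths V) : IsIso (Q.map ((mapC F).map ((evC i).map r))) :=
    isIso_Q_map_mapC_map R F (hC i) (hI2 i) _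
  let v (i : Paths V) : Q.obj ((mapC F).obj ((evC i).obj I)) ≅ Q.obj ((evC i).obj Z) :=
    (asIso (Q.map ((mapC F).map ((evC i).map r)))).symm ≪≫
      Q.mapIso ((mapC F).mapIso (e i)) ≪≫ u i
  have hv (a : Quiver.Total V) : (v a.src).hom ≫ Q.map (evCMap Z a.arrow) =
      Q.map ((mapC F).map (evCMap I a.arrow)) ≫ (v a.tgt).hom := by
    have h1 : Q.map ((mapC F).map (f a)) ≫ (u a.tgt).hom =
        (u a.src).hom ≫ Q.map (evCMap Z a.arrow) := by
      rw [hf, Category.assoc, Category.assoc, Iso.inv_hom_id, Category.comp_id]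
    have h2 : Q.map ((mapC F).map (evCMap C a.arrow)) ≫ Q.map ((mapC F).map (e a.tgt).hom) =
        Q.map ((mapC F).map (e a.src).hom) ≫ Q.map ((mapC F).map (f a)) := by
      rw [← Q.map_comp, ← (mapC F).map_comp, he, (mapC F).map_comp, Q.map_comp]
    have h3 : Q.map ((mapC F).map ((evC a.src).map r)) ≫
        Q.map ((mapC F).map (evCMap I a.arrow)) =
        Q.map ((mapC F).map (evCMap C a.arrow)) ≫ Q.map ((mapC F).map ((evC a.tgt).map r)) := by
      rw [← Q.map_comp, ← (mapC F).map_comp, evC_map_evCMap, (mapC F).map_comp, Q.map_comp]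
    simp only [v, Iso.trans_hom, Iso.symm_hom, asIso_inv, Functor.mapIso_hom, Category.assoc]
    rw [IsIso.inv_comp_eq, reassoc_of% h3, IsIso.hom_inv_id_assoc, reassoc_of% h2, h1]
  obtain ⟨φ, hφ⟩ := exists_evQ_eq (W := (mapC (functorOnDiagrams (Paths V) F)).obj I) (Z := Z)
    (fun i => (v i).hom) hv
  have : IsIso φ := isIso_of_evQ φ (fun i => by
    rw [hφ]
    exact inferInstanceAs (IsIso (v i).hom))
  exact ⟨I, hIQ, ⟨asIso φ⟩⟩

/-- If the right derived functor of `F` restricts to an equivalence between full subcategories of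
the bounded below derived categories, then so does the right derived functor of the functor induced
by `F` on representations of a finite quiver, for full subcategories which are defined
vertexwise. -/
lemma restrictsToEquivalence_functorOnDiagrams [EnoughInjectives (Paths V ⥤ A)]
    [R.IsClosedUnderIsomorphisms] [R'.IsClosedUnderIsomorphisms]
    [RQ.IsClosedUnderIsomorphisms] [RQ'.IsClosedUnderIsomorphisms]
    (hshift : ∀ X, R X → R (X⟦(-1 : ℤ)⟧))
    (hR : ∀ X, RQ (Q.obj X) ↔ ∀ i, R (Q.obj ((evC i).obj X)))
    (hR' : ∀ X, RQ' (Q.obj X) ↔ ∀ i, R' (Q.obj ((evC i).obj X)))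
    (h : RestrictsToEquivalence F.rightDerivedFunctorPlus (R.inverseImage Plus.ι)
        (R'.inverseImage Plus.ι)) :
    RestrictsToEquivalence (functorOnDiagrams (Paths V) F).rightDerivedFunctorPlus
      (RQ.inverseImage Plus.ι) (RQ'.inverseImage Plus.ι) := by
  rw [restrictsToEquivalence_rightDerivedFunctorPlus_iff] at h ⊢
  obtain ⟨h1, h2, h3⟩ := h
  refine ⟨fun X hX => ?_, ?_, exists_injectiveModel_diagram F hR hR' h2 h3⟩
  · exact (hR' _).2 fun i => h1 _ ((injectiveDiagramsInto_of_injectiveModels hR hX).2 i)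
  · have h4 := h2.functorOnDiagrams (V := V) F (fun X hX => injectiveModels_shift R hshift hX)
    exact
      { full := fun hX hY => h4.full (injectiveDiagramsInto_of_injectiveModels hR hX)
          (injectiveDiagramsInto_of_injectiveModels hR hY)
        faithful := fun hX hY => h4.faithful (injectiveDiagramsInto_of_injectiveModels hR hX)
          (injectiveDiagramsInto_of_injectiveModels hR hY) }

end Transfer

section PathCategories

instance functorsInto_isClosedUnderIsomorphisms {J : Type*} [Category* J] {E : Type*} [Category* E]
    (P : ObjectProperty E) [P.IsClosedUnderIsomorphisms] :
    (functorsInto J P).IsClosedUnderIsomorphisms where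
  of_iso e h j := P.prop_of_iso (e.app j) (h j)

/-- The exactness of countable coproducts, without restriction on the universe of the index type. -/
lemma hasExactColimitsOfShape_discrete_of_countable (B : Type*) [Category* B] [Abelian B]
    [HasCountableCoproducts B] [CountableAB4 B] (S : Type*) [Countable S] :
    HasExactColimitsOfShape (Discrete S) B := by
  have : Countable (Shrink.{0} S) := (equivShrink.{0} S).symm.countable_iff.2 inferInstance
  have : HasExactColimitsOfShape (Discrete (Shrink.{0} S)) B := CountableAB4.ofShape _
  exact HasExactColimitsOfShape.of_domain_equivalence B
    (Discrete.equivalence (equivShrink.{0} S).symm)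

end PathCategories

theorem theorem30
    {A : Type*} [Category* A] [Abelian A] [EnoughInjectives A] [HasDerivedCategory A]
    {B : Type*} [Category* B] [Abelian B] [HasDerivedCategory B]
    (F : A ⥤ B) [F.Additive] [PreservesFiniteLimits F]
    (A' : ObjectProperty A) (hA' : IsThickAbelian A')
    (B' : ObjectProperty B) (hB' : IsThickAbelian B')
    -- a finite quiver; `Paths V` is the category it generates
    (V : Type*) [Quiver V] [Finite V] [∀ i j : V, Finite (i ⟶ j)]
    (hV : (∀ (i : V) (p : Quiver.Path i i), p = Quiver.Path.nil) ∨
      (HasCountableProducts A ∧ ∃ _ : HasCountableCoproducts B, CountableAB4 B))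
    [HasDerivedCategory (Paths V ⥤ A)] [HasDerivedCategory (Paths V ⥤ B)] :
    ∃ _ : EnoughInjectives (Paths V ⥤ A),
      (RestrictsToEquivalence F.rightDerivedFunctorPlus
          (plusWithCohomologyIn A') (plusWithCohomologyIn B') →
        RestrictsToEquivalence (functorOnDiagrams (Paths V) F).rightDerivedFunctorPlus
          (plusWithCohomologyIn (functorsInto (Paths V) A'))
          (plusWithCohomologyIn (functorsInto (Paths V) B'))) ∧
      (RestrictsToEquivalence F.rightDerivedFunctorPlus
          (boundedWithCohomologyIn A') (boundedWithCohomologyIn B') →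
        RestrictsToEquivalence (functorOnDiagrams (Paths V) F).rightDerivedFunctorPlus
          (boundedWithCohomologyIn (functorsInto (Paths V) A'))
          (boundedWithCohomologyIn (functorsInto (Paths V) B'))) := by
  have : A'.IsClosedUnderIsomorphisms := hA'.isClosedUnderIsomorphisms
  have : B'.IsClosedUnderIsomorphisms := hB'.isClosedUnderIsomorphisms
  -- both cases provide products and exact coproducts indexed by the paths between two vertices
  obtain ⟨_, _, _⟩ : (∀ i j : Paths V, HasProductsOfShape (i ⟶ j) A) ∧
      ∃ _ : ∀ i j : Paths V, HasCoproductsOfShape (i ⟶ j) B,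
        ∀ i j : Paths V, HasExactColimitsOfShape (Discrete (i ⟶ j)) B := by
    rcases hV with hV | ⟨_, _, _⟩
    · have (i j : Paths V) : Finite (i ⟶ j) := finite_path_of_no_cycle hV i j
      have : HasFiniteBiproducts B := HasFiniteBiproducts.of_hasFiniteProducts
      exact ⟨fun i j => inferInstance, fun i j => inferInstance,
        fun i j => hasExactColimitsOfShape_discrete_finite B (i ⟶ j)⟩
    · have (i j : Paths V) : Countable (i ⟶ j) := countable_path (V := V) i j
      exact ⟨fun i j => inferInstance,
        fun i j => inferInstance,
        fun i j => hasExactColimitsOfShape_discrete_of_countable B (i ⟶ j)⟩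
  have hEI : EnoughInjectives (Paths V ⥤ A) := enoughInjectives_functor (Paths V) A
  refine ⟨hEI, fun h => ?_, fun h => ?_⟩
  · exact restrictsToEquivalence_functorOnDiagrams F (R := cohomologyIn A')
      (R' := cohomologyIn B') (RQ := cohomologyIn (functorsInto (Paths V) A'))
      (RQ' := cohomologyIn (functorsInto (Paths V) B'))
      (fun X hX => cohomologyIn_shift A' hX (-1))
      (cohomologyIn_functorsInto_iff A') (cohomologyIn_functorsInto_iff B') h
  · exact restrictsToEquivalence_functorOnDiagrams F
      (R := DerivedCategory.TStructure.t.bounded ⊓ cohomologyIn A')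
      (R' := DerivedCategory.TStructure.t.bounded ⊓ cohomologyIn B')
      (RQ := DerivedCategory.TStructure.t.bounded ⊓ cohomologyIn (functorsInto (Paths V) A'))
      (RQ' := DerivedCategory.TStructure.t.bounded ⊓ cohomologyIn (functorsInto (Paths V) B'))
      (fun X hX => ⟨bounded_shift hX.1 (-1), cohomologyIn_shift A' hX.2 (-1)⟩)
      (fun X => (and_congr (bounded_Q_obj_iff X) (cohomologyIn_functorsInto_iff A' X)).trans
        forall_and.symm)
      (fun X => (and_congr (bounded_Q_obj_iff X) (cohomologyIn_functorsInto_iff B' X)).trans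
        forall_and.symm) h
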